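/- Consider formal short normal-play games $G=\{G^L\mid G^R\}$, i.e. games built recursively from finitely many Left options $G^L$ and Right options $G^R$. "Equal" means equality of game values. A number is a game equal to a dyadic rational (an element of $\mathbb Z[\frac12]$ regarded as a game value), and a game is numberish if it is infinitesimally close to a number: $G-x$ is infinitesimal for some number $x$, that is, $-y<G-x<y$ for every number $y>0$. For $t\in\mathbb Z[\frac12]$ define $\lambda_t(G),\rho_t(G)\in\mathbb Z[\frac12]$ and the temperature $t(G)\in\mathbb Z[\frac12]\cup\{-\infty\}$ recursively as follows. * If $G$ is equal to an integer $n$, then $\lambda_t(G)=\rho_t(G)=n$ for all $t$, and $t(G)=-\infty$. * Otherwise, let $\tilde\lambda_t(G)=\max_{G^L}\{\rho_t(G^L)-t\}$, $\tilde\rho_t(G)=\min_{G^R}\{\lambda_t(G^R)+t\}$ and $t(G)=\min\{t\in\mathbb Z[\tfrac12] : \tilde\lambda_t(G)=\tilde\rho_t(G)\}$. For $t\le t(G)$ put $\lambda_t(G)=\tilde\lambda_t(G)$ and $\rho_t(G)=\tilde\rho_t(G)$; for $t>t(G)$ put $\lambda_t(G)=\rho_t(G)=x$, where $x=\tilde\lambda_{t(G)}(G)=\tilde\rho_{t(G)}(G)$.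 Then, for every such game $G$, the temperature is well defined (if $G$ is not equal to an integer, it has both Left and Right options and the above minimum exists), and 1. $t(G)<0$ if and only if $G$ is equal to a number; 2. $t(G)=0$ if and only if $G$ is numberish but not equal to any number; 3. $t(G)>0$ if and only if $G$ is not numberish. -/

import Mathlib

/-- The ring `ℤ[1/2]` of dyadic rationals, as a subring of `ℚ`. -/
def DyadicRationals : Subring ℚ where
  carrier := {q | ∃ (m : ℤ) (k : ℕ), q = (m : ℚ) / 2 ^ k}
  mul_mem' := by
    rintro _ _ ⟨m, k, rfl⟩ ⟨n, l, rfl⟩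
    exact ⟨m * n, k + l, by push_cast; rw [pow_add]; field_simp⟩
  one_mem' := ⟨1, 0, by norm_num⟩
  add_mem' := by
    rintro _ _ ⟨m, k, rfl⟩ ⟨n, l, rfl⟩
    exact ⟨m * 2 ^ l + n * 2 ^ k, k + l, by push_cast; rw [pow_add]; field_simp⟩
  zero_mem' := ⟨0, 0, by norm_num⟩
  neg_mem' := by
    rintro _ ⟨m, k, rfl⟩
    exact ⟨-m, k, by push_cast; ring⟩

/-- A (formal, short, loopfree, normal-play) combinatorial game `{G^L | G^R}`: finitely many
Left options and finitely many Right options, which are themselves such games. The options are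
listed as finite families. -/
inductive ShortGame : Type where
  | mk {m n : ℕ} (L : Fin m → ShortGame) (R : Fin n → ShortGame) : ShortGame

namespace ShortGame

/-- The number of (listed) Left options. -/
def numLeft : ShortGame → ℕ
  | @mk m _ _ _ => m

/-- The number of (listed) Right options. -/
def numRight : ShortGame → ℕ
  | @mk _ n _ _ => n

/-- The Left options `G^L`. -/
def left : (G : ShortGame) → Fin G.numLeft → ShortGame
  | mk L _ => L

/-- The Right options `G^R`. -/
def right : (G : ShortGame) → Fin G.numRight → ShortGame
  | mk _ R => R

/-- The formal birthday: the height of the game tree. -/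
def birthday : ShortGame → ℕ
  | mk L R => max (Finset.univ.sup fun i => birthday (L i) + 1)
      (Finset.univ.sup fun j => birthday (R j) + 1)

theorem birthday_left_lt (G : ShortGame) (i : Fin G.numLeft) :
    (G.left i).birthday < G.birthday := by
  cases G with
  | mk L R =>
    rw [birthday]
    exact lt_of_lt_of_le (Nat.lt_succ_self _)
      (le_max_of_le_left (Finset.le_sup (f := fun i => birthday (L i) + 1) (Finset.mem_univ i)))

theorem birthday_right_lt (G : ShortGame) (j : Fin G.numRight) :
    (G.right j).birthday < G.birthday := by
  cases G with
  | mk L R =>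
    rw [birthday]
    exact lt_of_lt_of_le (Nat.lt_succ_self _)
      (le_max_of_le_right (Finset.le_sup (f := fun j => birthday (R j) + 1) (Finset.mem_univ j)))

/-- The order of games: `G ≤ H` iff no Left option `G^L` satisfies `H ≤ G^L` and no Right option
`H^R` satisfies `H^R ≤ G`. -/
def Le (G H : ShortGame) : Prop :=
  (∀ i : Fin G.numLeft, ¬ Le H (G.left i)) ∧ (∀ j : Fin H.numRight, ¬ Le (H.right j) G)
termination_by G.birthday + H.birthday
decreasing_by
  · have := birthday_left_lt G i; omega
  · have := birthday_right_lt H j; omega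

/-- The strict order of games. -/
def Lt (G H : ShortGame) : Prop := Le G H ∧ ¬ Le H G

/-- Equality of game values: `G = H` iff `G ≤ H` and `H ≤ G`. -/
def Eqv (G H : ShortGame) : Prop := Le G H ∧ Le H G

/-- The negative `-G = {-G^R | -G^L}`. -/
def neg : ShortGame → ShortGame
  | mk L R => mk (fun j => neg (R j)) (fun i => neg (L i))

/-- The disjunctive sum `G + H = {G^L + H, G + H^L | G^R + H, G + H^R}`. -/
def add (G H : ShortGame) : ShortGame :=
  mk (Fin.append (fun i : Fin G.numLeft => add (G.left i) H)
      (fun i : Fin H.numLeft => add G (H.left i)))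
    (Fin.append (fun j : Fin G.numRight => add (G.right j) H)
      (fun j : Fin H.numRight => add G (H.right j)))
termination_by G.birthday + H.birthday
decreasing_by
  · have := birthday_left_lt G i; omega
  · have := birthday_left_lt H i; omega
  · have := birthday_right_lt G j; omega
  · have := birthday_right_lt H j; omega

/-- The difference `G - H = G + (-H)`. -/
def sub (G H : ShortGame) : ShortGame := add G (neg H)

/-- The zero game `{ | }`. -/
def zero : ShortGame := mk (fun i : Fin 0 => i.elim0) (fun j : Fin 0 => j.elim0)

/-- The canonical form of a natural number: `0 = { | }` and `n + 1 = {n | }`. -/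
def ofNat : ℕ → ShortGame
  | 0 => zero
  | n + 1 => mk (fun _ : Fin 1 => ofNat n) (fun j : Fin 0 => j.elim0)

/-- The canonical form of an integer. -/
def ofInt : ℤ → ShortGame
  | Int.ofNat n => ofNat n
  | Int.negSucc n => neg (ofNat (n + 1))

/-- The canonical form of the dyadic rational `m / 2 ^ k`: an integer if `k = 0`, and
`{(m - 1) / 2 ^ k | (m + 1) / 2 ^ k}` if `m` is odd and `k > 0`. -/
def ofDyadic (m : ℤ) : ℕ → ShortGame
  | 0 => ofInt m
  | k + 1 =>
    if m % 2 = 0 then ofDyadic (m / 2) k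
    else mk (fun _ : Fin 1 => ofDyadic ((m - 1) / 2) k) (fun _ : Fin 1 => ofDyadic ((m + 1) / 2) k)

/-- `G` is equal to an integer. -/
def IsInteger (G : ShortGame) : Prop := ∃ n : ℤ, Eqv G (ofInt n)

/-- `G` is equal to a number, that is, to a dyadic rational. -/
def IsNumber (G : ShortGame) : Prop := ∃ (m : ℤ) (k : ℕ), Eqv G (ofDyadic m k)

/-- `G` is infinitesimal: `-x < G < x` for all numbers `x > 0`. -/
def IsInfinitesimal (G : ShortGame) : Prop :=
  ∀ x : ShortGame, IsNumber x → Lt zero x → Lt (neg x) G ∧ Lt G x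

/-- `G` is numberish: it is infinitesimally close to a number. -/
def IsNumberish (G : ShortGame) : Prop :=
  ∃ x : ShortGame, IsNumber x ∧ IsInfinitesimal (sub G x)

/-- The maximum of a nonempty finite family (and `0` for the empty family). -/
def maxOver {n : ℕ} (f : Fin n → DyadicRationals) : DyadicRationals :=
  if h : (Finset.univ : Finset (Fin n)).Nonempty then Finset.univ.sup' h f else 0

/-- The minimum of a nonempty finite family (and `0` for the empty family). -/
def minOver {n : ℕ} (f : Fin n → DyadicRationals) : DyadicRationals :=
  if h : (Finset.univ : Finset (Fin n)).Nonempty then Finset.univ.inf' h f else 0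

/-- The thermographic data of a game `G`: the left wall `t ↦ λ_t(G)`, the right wall
`t ↦ ρ_t(G)`, and the temperature `t(G)`, where `⊥` stands for `-∞`. -/
structure Thermograph where
  leftWall : DyadicRationals → DyadicRationals
  rightWall : DyadicRationals → DyadicRationals
  temp : WithBot DyadicRationals

open Classical in
/-- The thermograph with temperature `t(G) = min {t | lt t = rt t}` whose walls are `lt` and `rt`
up to `t(G)` and constant from there on. The last branch is a default value for the case that
the minimum does not exist. -/
noncomputable def Thermograph.ofScaffolds (lt rt : DyadicRationals → DyadicRationals) :
    Thermograph :=
  if h : ∃ τ, IsLeast {t | lt t = rt t} τ then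
    { leftWall := fun t => if t ≤ h.choose then lt t else lt h.choose
      rightWall := fun t => if t ≤ h.choose then rt t else rt h.choose
      temp := (h.choose : DyadicRationals) }
  else { leftWall := lt, rightWall := rt, temp := ⊥ }

open Classical in
/-- The thermograph of a game, by recursion on the game. If `G` is equal to an integer `n`, both
walls are constantly `n` and the temperature is `-∞`. Otherwise it is built from
`max_{G^L} (ρ_t(G^L) - t)` and `min_{G^R} (λ_t(G^R) + t)`. -/
noncomputable def thermograph : ShortGame → Thermograph
  | mk L R =>
    if h : IsInteger (mk L R) then
      { leftWall := fun _ => (h.choose : DyadicRationals)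
        rightWall := fun _ => (h.choose : DyadicRationals)
        temp := ⊥ }
    else
      Thermograph.ofScaffolds
        (fun t => maxOver fun i => (thermograph (L i)).rightWall t - t)
        (fun t => minOver fun j => (thermograph (R j)).leftWall t + t)

/-- `λ_t(G)`. -/
noncomputable def leftWall (G : ShortGame) (t : DyadicRationals) : DyadicRationals :=
  G.thermograph.leftWall t

/-- `ρ_t(G)`. -/
noncomputable def rightWall (G : ShortGame) (t : DyadicRationals) : DyadicRationals :=
  G.thermograph.rightWall t

/-- The temperature `t(G)`, an element of `ℤ[1/2] ∪ {-∞}`. -/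
noncomputable def temperature (G : ShortGame) : WithBot DyadicRationals :=
  G.thermograph.temp

/-- The left scaffold `max_{G^L} (ρ_t(G^L) - t)`. -/
noncomputable def leftScaffold (G : ShortGame) (t : DyadicRationals) : DyadicRationals :=
  maxOver fun i => (G.left i).rightWall t - t

/-- The right scaffold `min_{G^R} (λ_t(G^R) + t)`. -/
noncomputable def rightScaffold (G : ShortGame) (t : DyadicRationals) : DyadicRationals :=
  minOver fun j => (G.right j).leftWall t + t

theorem thermograph_of_not_isInteger (G : ShortGame) (h : ¬ G.IsInteger) :
    G.thermograph = Thermograph.ofScaffolds G.leftScaffold G.rightScaffold := by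
  cases G with
  | mk L R => rw [thermograph, dif_neg h]; rfl

end ShortGame

/-! ### The order on games -/

namespace ShortGame

/-! The thermograph at the negative temperatures t = -2^(-k) records rounding to the grid 2^(-k)ℤ:
λ_t(G) is the least grid point ≥ G and ρ_t(G) the greatest grid point ≤ G (`WallsApproximate`). This
goes by induction on G. If G is not on the grid, the simplicity theorem (`exists_eqv_ofDyadic`)
shows that G ≤ x, for a grid point x, exactly when no G^L is ≥ x. By induction this says that
ρ_t(G^L) < x for all G^L, and on the grid that means ρ_t(G^L) - t ≤ x: the tax t is exactly one grid
step. So the scaffolds give the rounding, and they are still strictly crossed at t, whence t(G) >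
-2^(-k). If G is a noninteger number on the grid, its scaffolds have already met at its value and t
lies on the mast (`mast_of_eqv_ofDyadic`).

Hence a noninteger number has negative temperature, and a non-number has t(G) > -2^(-k) for every k,
so t(G) ≥ 0. For a non-number the scaffolds at 0 differ by at most 2^(-k) from those at -2^(-k), so
they are the limits of the upper and lower roundings of G. They agree exactly when G is
infinitesimally close to a number (`crossing_eq_zero_iff`).

Because ℤ[1/2] is not complete, the least crossing needs its own argument. Left walls and negated
right walls have slopes 0 and -1 with breakpoints on a dyadic grid, so crossing scaffolds first meet
at a grid point or halfway between two (`IsWall.exists_isLeast_crossing`). -/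

theorem le_iff {G H : ShortGame} :
    Le G H ↔ (∀ i, ¬ Le H (G.left i)) ∧ ∀ j, ¬ Le (H.right j) G := by
  rw [Le]

theorem le_refl (G : ShortGame) : Le G G := by
  suffices h : ∀ n (G : ShortGame), G.birthday = n → Le G G from h _ G rfl
  intro n
  induction n using Nat.strong_induction_on with
  | _ n ih =>
    rintro G rfl
    rw [le_iff]
    refine ⟨fun i h => (le_iff.1 h).1 i (ih _ (G.birthday_left_lt i) _ rfl),
      fun j h => (le_iff.1 h).2 j (ih _ (G.birthday_right_lt j) _ rfl)⟩

theorem le_trans {G H K : ShortGame} (h₁ : Le G H) (h₂ : Le H K) : Le G K := by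
  suffices h : ∀ n (G H K : ShortGame), G.birthday + H.birthday + K.birthday = n →
      Le G H → Le H K → Le G K from h _ G H K rfl h₁ h₂
  intro n
  induction n using Nat.strong_induction_on with
  | _ n ih =>
    rintro G H K rfl h₁ h₂
    rw [le_iff]
    refine ⟨fun i h => (le_iff.1 h₁).1 i (ih _ ?_ H K _ rfl h₂ h),
      fun j h => (le_iff.1 h₂).2 j (ih _ ?_ _ G H rfl h h₁)⟩
    · have := G.birthday_left_lt i; omega
    · have := K.birthday_right_lt j; omega

theorem not_le_left (G : ShortGame) (i) : ¬ Le G (G.left i) := (le_iff.1 (le_refl G)).1 i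

theorem not_right_le (G : ShortGame) (j) : ¬ Le (G.right j) G := (le_iff.1 (le_refl G)).2 j

theorem left_not_ge {G H : ShortGame} (h : Le G H) (i) : ¬ Le H (G.left i) := (le_iff.1 h).1 i

theorem right_not_le {G H : ShortGame} (h : Le G H) (j) : ¬ Le (H.right j) G := (le_iff.1 h).2 j

theorem Eqv.symm {G H : ShortGame} (h : Eqv G H) : Eqv H G := ⟨h.2, h.1⟩

theorem Eqv.trans {G H K : ShortGame} (h : Eqv G H) (h' : Eqv H K) : Eqv G K :=
  ⟨le_trans h.1 h'.1, le_trans h'.2 h.2⟩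

/-! ### Negation -/

/-- Quantifying over a predicate avoids casts between the index types of `G.neg` and `G`; sums are
treated in the same way below. -/
theorem left_neg_iff {G : ShortGame} {P : ShortGame → Prop} :
    (∀ i, P (G.neg.left i)) ↔ ∀ j, P (G.right j).neg := by
  cases G; rfl

theorem right_neg_iff {G : ShortGame} {P : ShortGame → Prop} :
    (∀ j, P (G.neg.right j)) ↔ ∀ i, P (G.left i).neg := by
  cases G; rfl

theorem neg_neg (G : ShortGame) : G.neg.neg = G := by
  induction G with
  | mk L R ihL ihR => simp only [neg, ihL, ihR]

theorem neg_le_neg_of_le {G H : ShortGame} (h : Le G H) : Le H.neg G.neg := by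
  suffices h' : ∀ n (G H : ShortGame), G.birthday + H.birthday = n →
      (Le G H ↔ Le H.neg G.neg) from (h' _ G H rfl).1 h
  intro n
  induction n using Nat.strong_induction_on with
  | _ n ih =>
    rintro G H rfl
    rw [le_iff, le_iff (G := H.neg), left_neg_iff (P := fun X => ¬ Le G.neg X),
      right_neg_iff (P := fun X => ¬ Le X H.neg), and_comm]
    refine and_congr (forall_congr' fun j => not_congr (ih _ ?_ _ _ rfl))
      (forall_congr' fun i => not_congr (ih _ ?_ _ _ rfl))
    · have := H.birthday_right_lt j; omega
    · have := G.birthday_left_lt i; omega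

/-! ### Addition -/

theorem left_add_iff {G H : ShortGame} {P : ShortGame → Prop} :
    (∀ i, P ((G.add H).left i)) ↔
      (∀ i, P ((G.left i).add H)) ∧ ∀ i, P (G.add (H.left i)) := by
  rw [add]
  simp only [left, numLeft]
  constructor
  · intro h
    exact ⟨fun i => by simpa using h (Fin.castAdd _ i), fun i => by simpa using h (Fin.natAdd _ i)⟩
  · rintro ⟨h₁, h₂⟩ i
    induction i using Fin.addCases with
    | left i => simpa using h₁ i
    | right i => simpa using h₂ i

theorem right_add_iff {G H : ShortGame} {P : ShortGame → Prop} :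
    (∀ j, P ((G.add H).right j)) ↔
      (∀ j, P ((G.right j).add H)) ∧ ∀ j, P (G.add (H.right j)) := by
  rw [add]
  simp only [right, numRight]
  constructor
  · intro h
    exact ⟨fun i => by simpa using h (Fin.castAdd _ i), fun i => by simpa using h (Fin.natAdd _ i)⟩
  · rintro ⟨h₁, h₂⟩ i
    induction i using Fin.addCases with
    | left i => simpa using h₁ i
    | right i => simpa using h₂ i

/-- Subtracting `H` is both a left and a right adjoint of adding `H`. -/
theorem sub_le_iff_and_le_sub_iff (G H K : ShortGame) :
    (Le (G.sub H) K ↔ Le G (K.add H)) ∧ (Le K (G.sub H) ↔ Le (K.add H) G) := by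
  suffices h : ∀ n (G H K : ShortGame), G.birthday + H.birthday + K.birthday = n →
      (Le (G.sub H) K ↔ Le G (K.add H)) ∧ (Le K (G.sub H) ↔ Le (K.add H) G) from h _ G H K rfl
  intro n
  induction n using Nat.strong_induction_on with
  | _ n ih =>
    rintro G H K rfl
    have hGL : ∀ i, _ := fun i => ih _ (by have := G.birthday_left_lt i; omega) (G.left i) H K rfl
    have hGR : ∀ i, _ := fun i => ih _ (by have := G.birthday_right_lt i; omega) (G.right i) H K rfl
    have hHL : ∀ i, _ := fun i => ih _ (by have := H.birthday_left_lt i; omega) G (H.left i) K rfl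
    have hHR : ∀ i, _ := fun i => ih _ (by have := H.birthday_right_lt i; omega) G (H.right i) K rfl
    have hKL : ∀ i, _ := fun i => ih _ (by have := K.birthday_left_lt i; omega) G H (K.left i) rfl
    have hKR : ∀ i, _ := fun i => ih _ (by have := K.birthday_right_lt i; omega) G H (K.right i) rfl
    simp only [sub] at *
    constructor
    -- Unfolding an inequality of either kind leaves only negated inequalities of the other kind, so
    -- the two equivalences need a joint induction.
    · rw [le_iff, le_iff (G := G), left_add_iff (P := fun X => ¬ Le K X),
        right_add_iff (P := fun X => ¬ Le X G),
        left_neg_iff (P := fun X => ¬ Le K (G.add X))]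
      simp only [hGL, hHR, hKR]
      tauto
    · rw [le_iff, le_iff (H := G), left_add_iff (P := fun X => ¬ Le G X),
        right_add_iff (P := fun X => ¬ Le X K),
        right_neg_iff (P := fun X => ¬ Le (G.add X) K)]
      simp only [hGR, hHL, hKL]
      tauto

theorem sub_le_iff {G H K : ShortGame} : Le (G.sub H) K ↔ Le G (K.add H) :=
  (sub_le_iff_and_le_sub_iff G H K).1

theorem le_sub_iff {G H K : ShortGame} : Le K (G.sub H) ↔ Le (K.add H) G :=
  (sub_le_iff_and_le_sub_iff G H K).2

theorem add_le_add_left {G G' : ShortGame} (h : Le G G') (H : ShortGame) :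
    Le (G.add H) (G'.add H) :=
  le_sub_iff.1 (le_trans h (le_sub_iff.2 (le_refl _)))

theorem add_le_comm (G H : ShortGame) : Le (G.add H) (H.add G) := by
  suffices h : ∀ n (G H : ShortGame), G.birthday + H.birthday = n →
      Le (G.add H) (H.add G) from h _ G H rfl
  intro n
  induction n using Nat.strong_induction_on with
  | _ n ih =>
    rintro G H rfl
    have hGL : ∀ i, _ := fun i => ih _ (by have := G.birthday_left_lt i; omega) (G.left i) H rfl
    have hGR : ∀ i, _ := fun i => ih _ (by have := G.birthday_right_lt i; omega) (G.right i) H rfl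
    have hHL : ∀ i, _ := fun i => ih _ (by have := H.birthday_left_lt i; omega) G (H.left i) rfl
    have hHR : ∀ i, _ := fun i => ih _ (by have := H.birthday_right_lt i; omega) G (H.right i) rfl
    have hl := (left_add_iff (P := fun X => ¬ Le (H.add G) X)).1 (not_le_left (H.add G))
    have hr := (right_add_iff (P := fun X => ¬ Le X (G.add H))).1 (not_right_le (G.add H))
    rw [le_iff, left_add_iff (P := fun X => ¬ Le (H.add G) X),
      right_add_iff (P := fun X => ¬ Le X (G.add H))]
    exact ⟨⟨fun i h => hl.2 i (le_trans h (hGL i)), fun i h => hl.1 i (le_trans h (hHL i))⟩,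
      ⟨fun i h => hr.2 i (le_trans (hHR i) h), fun i h => hr.1 i (le_trans (hGR i) h)⟩⟩

theorem add_le_add_right {H H' : ShortGame} (h : Le H H') (G : ShortGame) :
    Le (G.add H) (G.add H') :=
  le_trans (add_le_comm _ _) (le_trans (add_le_add_left h G) (add_le_comm _ _))

/-! ### Canonical forms of dyadic rationals -/

theorem ofDyadic_two_mul (m : ℤ) (k : ℕ) : ofDyadic (2 * m) (k + 1) = ofDyadic m k := by
  rw [ofDyadic, if_pos (by omega)]
  congr 1
  omega

theorem ofDyadic_two_mul_add_one (m : ℤ) (k : ℕ) :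
    ofDyadic (2 * m + 1) (k + 1) =
      mk (fun _ : Fin 1 => ofDyadic m k) (fun _ : Fin 1 => ofDyadic (m + 1) k) := by
  rw [ofDyadic, if_neg (by omega), show (2 * m + 1 - 1) / 2 = m by omega,
    show (2 * m + 1 + 1) / 2 = m + 1 by omega]

/-- Canonical forms do not change under refinement of the grid, even as formal games, so dyadic
rationals can always be moved to a common denominator. -/
theorem ofDyadic_mul_pow (m : ℤ) (k j : ℕ) : ofDyadic (m * 2 ^ j) (k + j) = ofDyadic m k := by
  induction j with
  | zero => simp
  | succ j ih =>
    rw [← ih, ← ofDyadic_two_mul (m * 2 ^ j), pow_succ, ← mul_assoc, mul_comm _ 2, ← add_assoc]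

theorem exists_ofDyadic_eq {m : ℤ} {k j : ℕ} (h : k ≤ j) :
    ofDyadic m k = ofDyadic (m * 2 ^ (j - k)) j := by
  conv_rhs => rw [← Nat.add_sub_cancel' h]
  simp [ofDyadic_mul_pow]

theorem zero_neg : zero.neg = zero := by
  simp only [zero, neg]
  congr <;> exact Subsingleton.elim _ _

theorem ofInt_neg (n : ℤ) : ofInt (-n) = (ofInt n).neg := by
  rcases n with (_ | n) | n
  · exact zero_neg.symm
  · rfl
  · exact (neg_neg _).symm

theorem ofDyadic_neg (m : ℤ) (k : ℕ) : ofDyadic (-m) k = (ofDyadic m k).neg := by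
  induction k generalizing m with
  | zero => exact ofInt_neg m
  | succ k ih =>
    obtain ⟨a, rfl | rfl⟩ := Int.even_or_odd' m
    · rw [show -(2 * a) = 2 * (-a) by ring, ofDyadic_two_mul, ofDyadic_two_mul, ih]
    · rw [show -(2 * a + 1) = 2 * (-a - 1) + 1 by ring, ofDyadic_two_mul_add_one,
        ofDyadic_two_mul_add_one, neg, show -a - 1 = -(a + 1) by ring, ih,
        show -(a + 1) + 1 = -a by ring, ih]

/-- The options of the canonical form of a dyadic rational. -/
theorem ofDyadic_left (m : ℤ) (k : ℕ) (i) :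
    ∃ n < m, (ofDyadic m k).left i = ofDyadic n k := by
  induction k generalizing m with
  | zero =>
    rcases m with (_ | n) | n
    · exact i.elim0
    · exact ⟨n, by simp, rfl⟩
    · exact i.elim0
  | succ k ih =>
    obtain ⟨a, rfl | rfl⟩ := Int.even_or_odd' m
    · revert i
      rw [ofDyadic_two_mul]
      intro i
      obtain ⟨n, hn, h⟩ := ih a i
      exact ⟨2 * n, by omega, by rw [h, ofDyadic_two_mul]⟩
    · revert i
      rw [ofDyadic_two_mul_add_one]
      intro i
      exact ⟨2 * a, by omega, by rw [ofDyadic_two_mul]; rfl⟩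

theorem ofDyadic_right (m : ℤ) (k : ℕ) (j) :
    ∃ n > m, (ofDyadic m k).right j = ofDyadic n k := by
  -- Right options of x are negatives of left options of -x.
  have key : ∀ (P : ShortGame → Prop), (∀ n > m, P (ofDyadic n k)) →
      ∀ j, P ((ofDyadic m k).right j) := by
    intro P hP
    rw [← neg_neg (ofDyadic m k), right_neg_iff, ← ofDyadic_neg]
    intro i
    obtain ⟨n, hn, h⟩ := ofDyadic_left (-m) k i
    rw [h, ← ofDyadic_neg]
    exact hP _ (by omega)
  exact key (fun X => ∃ n > m, X = ofDyadic n k) (fun n hn => ⟨n, hn, rfl⟩) j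

theorem ofInt_lt_add_one (n : ℤ) :
    Le (ofInt n) (ofInt (n + 1)) ∧ ¬ Le (ofInt (n + 1)) (ofInt n) := by
  have h : ∀ n : ℕ, Le (ofNat n) (ofNat (n + 1)) := by
    intro n
    induction n with
    | zero => rw [le_iff]; exact ⟨fun i => i.elim0, fun j => j.elim0⟩
    | succ n ih =>
      rw [le_iff]
      exact ⟨fun _ h => not_le_left (ofNat (n + 2)) (0 : Fin 1) (le_trans h ih), fun j => j.elim0⟩
  have h' : ∀ n : ℕ, ¬ Le (ofNat (n + 1)) (ofNat n) :=
    fun n => not_le_left (ofNat (n + 1)) (0 : Fin 1)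
  rcases n with n | n
  · exact ⟨h n, h' n⟩
  · rw [show Int.negSucc n + 1 = -(n : ℤ) by omega, ofInt_neg]
    refine ⟨neg_le_neg_of_le (h n), fun hn => h' n ?_⟩
    have := neg_le_neg_of_le hn
    rwa [neg_neg, ofInt, neg_neg] at this

theorem ofDyadic_le_iff_of_lt_add_one {k : ℕ}
    (h : ∀ m, Le (ofDyadic m k) (ofDyadic (m + 1) k) ∧ ¬ Le (ofDyadic (m + 1) k) (ofDyadic m k))
    {m n : ℤ} : Le (ofDyadic m k) (ofDyadic n k) ↔ m ≤ n := by
  have mono : ∀ {m n : ℤ}, m ≤ n → Le (ofDyadic m k) (ofDyadic n k) := by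
    intro m n hmn
    induction n, hmn using Int.leInduction with
    | base => exact le_refl _
    | succ n _ ih => exact le_trans ih (h n).1
  refine ⟨fun hmn => ?_, mono⟩
  by_contra! hlt
  exact (h n).2 (le_trans (mono hlt) hmn)

/-- Of two neighbours on the grid of step 2^(-(k+1)), one has odd numerator, and the other lies on
the coarser grid and is an option of it; this gives strictness, and the induction hypothesis handles
the remaining options. -/
theorem ofDyadic_lt_add_one (m : ℤ) (k : ℕ) :
    Le (ofDyadic m k) (ofDyadic (m + 1) k) ∧ ¬ Le (ofDyadic (m + 1) k) (ofDyadic m k) := by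
  induction k generalizing m with
  | zero => exact ofInt_lt_add_one m
  | succ k ih =>
    have hk : ∀ {m n : ℤ}, Le (ofDyadic m k) (ofDyadic n k) ↔ m ≤ n :=
      ofDyadic_le_iff_of_lt_add_one ih
    obtain ⟨a, rfl | rfl⟩ := Int.even_or_odd' m
    · rw [ofDyadic_two_mul, ofDyadic_two_mul_add_one]
      refine ⟨?_, not_le_left (mk _ _) (0 : Fin 1)⟩
      rw [le_iff]
      refine ⟨fun i hi => ?_, fun _ => (ih a).2⟩
      obtain ⟨n, hn, h⟩ := ofDyadic_left a k i
      rw [h] at hi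
      exact not_le_left (mk _ _) (0 : Fin 1) (le_trans hi (hk.2 hn.le))
    · rw [show 2 * a + 1 + 1 = 2 * (a + 1) by ring, ofDyadic_two_mul, ofDyadic_two_mul_add_one]
      have hX : ¬ Le (ofDyadic (a + 1) k) (mk (fun _ : Fin 1 => ofDyadic a k)
          (fun _ : Fin 1 => ofDyadic (a + 1) k)) :=
        not_right_le (mk (fun _ : Fin 1 => ofDyadic a k)
          (fun _ : Fin 1 => ofDyadic (a + 1) k)) (0 : Fin 1)
      refine ⟨?_, hX⟩
      rw [le_iff]
      refine ⟨fun _ => (ih a).2, fun i hi => ?_⟩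
      obtain ⟨n, hn, h⟩ := ofDyadic_right (a + 1) k i
      rw [h] at hi
      exact hX (le_trans (hk.2 hn.le) hi)

theorem ofDyadic_le_iff {m n : ℤ} {k : ℕ} : Le (ofDyadic m k) (ofDyadic n k) ↔ m ≤ n :=
  ofDyadic_le_iff_of_lt_add_one fun m => ofDyadic_lt_add_one m k

/-- The next grid point is a right option except when the fraction reduces or is a nonnegative
integer, which has no right option. This supplies the answering move in `ofDyadic_add`. -/
theorem ofDyadic_right_one (m : ℤ) (k : ℕ) : (∃ a, k ≠ 0 ∧ m = 2 * a) ∨ (k = 0 ∧ 0 ≤ m) ∨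
    ∃ j, (ofDyadic m k).right j = ofDyadic (m + 1) k := by
  rcases k with _ | k
  · rcases m with m | m
    · exact Or.inr (Or.inl ⟨rfl, by simp⟩)
    · refine Or.inr (Or.inr ⟨(0 : Fin 1), ?_⟩)
      rw [show Int.negSucc m + 1 = -(m : ℤ) by omega, ofDyadic_neg]
      rfl
  · obtain ⟨a, rfl | rfl⟩ := Int.even_or_odd' m
    · exact Or.inl ⟨a, by simp⟩
    · refine Or.inr (Or.inr ?_)
      rw [show 2 * a + 1 + 1 = 2 * (a + 1) by ring, ofDyadic_two_mul, ofDyadic_two_mul_add_one]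
      exact ⟨(0 : Fin 1), rfl⟩

theorem ofDyadic_left_one (m : ℤ) (k : ℕ) : (∃ a, k ≠ 0 ∧ m = 2 * a) ∨ (k = 0 ∧ m ≤ 0) ∨
    ∃ j, (ofDyadic m k).left j = ofDyadic (m - 1) k := by
  rcases k with _ | k
  · rcases m with (_ | m) | m
    · exact Or.inr (Or.inl ⟨rfl, by simp⟩)
    · refine Or.inr (Or.inr ⟨(0 : Fin 1), ?_⟩)
      rw [show Int.ofNat (m + 1) - 1 = m by simp]
      rfl
    · exact Or.inr (Or.inl ⟨rfl, by omega⟩)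
  · obtain ⟨a, rfl | rfl⟩ := Int.even_or_odd' m
    · exact Or.inl ⟨a, by simp⟩
    · refine Or.inr (Or.inr ?_)
      rw [show 2 * a + 1 - 1 = 2 * a by ring, ofDyadic_two_mul, ofDyadic_two_mul_add_one]
      exact ⟨(0 : Fin 1), rfl⟩

theorem ofDyadic_zero_right_nonneg {m : ℤ} (hm : 0 ≤ m) (j : Fin (ofDyadic m 0).numRight) :
    False := by
  lift m to ℕ using hm
  rcases m with _ | m <;> exact j.elim0

theorem ofDyadic_zero_left_nonpos {m : ℤ} (hm : m ≤ 0) (j : Fin (ofDyadic m 0).numLeft) :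
    False := by
  rcases m with (_ | m) | m
  · exact j.elim0
  · simp at hm; omega
  · exact j.elim0

theorem ofDyadic_add (m n : ℤ) (k : ℕ) :
    Eqv ((ofDyadic m k).add (ofDyadic n k)) (ofDyadic (m + n) k) := by
  suffices h : ∀ b k m n, (ofDyadic m k).birthday + (ofDyadic n k).birthday + k = b →
      Eqv ((ofDyadic m k).add (ofDyadic n k)) (ofDyadic (m + n) k) from h _ k m n rfl
  intro b
  induction b using Nat.strong_induction_on with
  | _ b ih =>
    rintro k m n rfl
    -- If both fractions reduce, the canonical forms stay the same and only k drops; this is why k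
    -- is part of the induction measure.
    by_cases heven : ∃ a c, k ≠ 0 ∧ m = 2 * a ∧ n = 2 * c
    · obtain ⟨a, c, hk, rfl, rfl⟩ := heven
      obtain ⟨k, rfl⟩ := Nat.exists_eq_succ_of_ne_zero hk
      rw [← mul_add]
      simp only [Nat.succ_eq_add_one, ofDyadic_two_mul] at ih ⊢
      exact ih _ (by omega) k a c rfl
    have hl₁ : ∀ i, ∃ p < m + n, Eqv (((ofDyadic m k).left i).add (ofDyadic n k))
        (ofDyadic p k) := by
      intro i
      obtain ⟨p, hp, h⟩ := ofDyadic_left m k i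
      have hb := birthday_left_lt _ i
      rw [h] at hb ⊢
      exact ⟨p + n, by omega, ih _ (by omega) _ _ _ rfl⟩
    have hl₂ : ∀ i, ∃ p < m + n, Eqv ((ofDyadic m k).add ((ofDyadic n k).left i))
        (ofDyadic p k) := by
      intro i
      obtain ⟨p, hp, h⟩ := ofDyadic_left n k i
      have hb := birthday_left_lt _ i
      rw [h] at hb ⊢
      exact ⟨m + p, by omega, ih _ (by omega) _ _ _ rfl⟩
    have hr₁ : ∀ i, ∃ p > m + n, Eqv (((ofDyadic m k).right i).add (ofDyadic n k))
        (ofDyadic p k) := by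
      intro i
      obtain ⟨p, hp, h⟩ := ofDyadic_right m k i
      have hb := birthday_right_lt _ i
      rw [h] at hb ⊢
      exact ⟨p + n, by omega, ih _ (by omega) _ _ _ rfl⟩
    have hr₂ : ∀ i, ∃ p > m + n, Eqv ((ofDyadic m k).add ((ofDyadic n k).right i))
        (ofDyadic p k) := by
      intro i
      obtain ⟨p, hp, h⟩ := ofDyadic_right n k i
      have hb := birthday_right_lt _ i
      rw [h] at hb ⊢
      exact ⟨m + p, by omega, ih _ (by omega) _ _ _ rfl⟩
    constructor
    · rw [le_iff, left_add_iff (P := fun X => ¬ Le (ofDyadic (m + n) k) X)]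
      refine ⟨⟨fun i h => ?_, fun i h => ?_⟩, fun j h => ?_⟩
      · obtain ⟨p, hp, hX⟩ := hl₁ i
        have := ofDyadic_le_iff.1 (le_trans h hX.1)
        omega
      · obtain ⟨p, hp, hX⟩ := hl₂ i
        have := ofDyadic_le_iff.1 (le_trans h hX.1)
        omega
      · obtain ⟨p, hp, hT⟩ := ofDyadic_right (m + n) k j
        rw [hT] at h
        have hX := (right_add_iff
          (P := fun X => ¬ Le X ((ofDyadic m k).add (ofDyadic n k)))).1 (not_right_le _)
        have hm := ofDyadic_right_one m k
        have hn := ofDyadic_right_one n k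
        -- A right option of m + n exists here, so m and n are not both nonnegative integers. Hence
        -- some summand can move to its right neighbour, and the sum then reaches m + n + 1, which
        -- is at most that option.
        have hnot : ¬ (k = 0 ∧ 0 ≤ m ∧ 0 ≤ n) := by
          rintro ⟨rfl, h₁, h₂⟩
          exact ofDyadic_zero_right_nonneg (by omega) j
        rcases (by
          by_contra hcon
          push Not at hcon
          rcases hm with ⟨a, ha⟩ | ha | ⟨i, hi⟩
          · rcases hn with ⟨c, hc⟩ | hc | ⟨i, hi⟩
            · exact heven ⟨a, c, ha.1, ha.2, hc.2⟩
            · exact ha.1 hc.1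
            · exact hcon.2 i hi
          · rcases hn with ⟨c, hc⟩ | hc | ⟨i, hi⟩
            · exact hc.1 ha.1
            · exact hnot ⟨ha.1, ha.2, hc.2⟩
            · exact hcon.2 i hi
          · exact hcon.1 i hi :
          (∃ i, (ofDyadic m k).right i = ofDyadic (m + 1) k) ∨
            ∃ i, (ofDyadic n k).right i = ofDyadic (n + 1) k) with ⟨i, hi⟩ | ⟨i, hi⟩
        · have hb := birthday_right_lt _ i
          have hX := hX.1 i
          rw [hi] at hb hX
          have := (ih _ (by omega) k (m + 1) n rfl).1
          exact hX (le_trans this (le_trans (ofDyadic_le_iff.2 (by omega)) h))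
        · have hb := birthday_right_lt _ i
          have hX := hX.2 i
          rw [hi] at hb hX
          have := (ih _ (by omega) k m (n + 1) rfl).1
          exact hX (le_trans this (le_trans (ofDyadic_le_iff.2 (by omega)) h))
    · rw [le_iff, right_add_iff (P := fun X => ¬ Le X (ofDyadic (m + n) k))]
      refine ⟨fun j h => ?_, ⟨fun i h => ?_, fun i h => ?_⟩⟩
      · obtain ⟨p, hp, hT⟩ := ofDyadic_left (m + n) k j
        rw [hT] at h
        have hX := (left_add_iff
          (P := fun X => ¬ Le ((ofDyadic m k).add (ofDyadic n k)) X)).1 (not_le_left _)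
        have hm := ofDyadic_left_one m k
        have hn := ofDyadic_left_one n k
        have hnot : ¬ (k = 0 ∧ m ≤ 0 ∧ n ≤ 0) := by
          rintro ⟨rfl, h₁, h₂⟩
          exact ofDyadic_zero_left_nonpos (by omega) j
        rcases (by
          by_contra hcon
          push Not at hcon
          rcases hm with ⟨a, ha⟩ | ha | ⟨i, hi⟩
          · rcases hn with ⟨c, hc⟩ | hc | ⟨i, hi⟩
            · exact heven ⟨a, c, ha.1, ha.2, hc.2⟩
            · exact ha.1 hc.1
            · exact hcon.2 i hi
          · rcases hn with ⟨c, hc⟩ | hc | ⟨i, hi⟩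
            · exact hc.1 ha.1
            · exact hnot ⟨ha.1, ha.2, hc.2⟩
            · exact hcon.2 i hi
          · exact hcon.1 i hi :
          (∃ i, (ofDyadic m k).left i = ofDyadic (m - 1) k) ∨
            ∃ i, (ofDyadic n k).left i = ofDyadic (n - 1) k) with ⟨i, hi⟩ | ⟨i, hi⟩
        · have hb := birthday_left_lt _ i
          have hX := hX.1 i
          rw [hi] at hb hX
          have := (ih _ (by omega) k (m - 1) n rfl).2
          exact hX (le_trans h (le_trans (ofDyadic_le_iff.2 (by omega)) this))
        · have hb := birthday_left_lt _ i
          have hX := hX.2 i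
          rw [hi] at hb hX
          have := (ih _ (by omega) k m (n - 1) rfl).2
          exact hX (le_trans h (le_trans (ofDyadic_le_iff.2 (by omega)) this))
      · obtain ⟨p, hp, hX⟩ := hr₁ i
        have := ofDyadic_le_iff.1 (le_trans hX.2 h)
        omega
      · obtain ⟨p, hp, hX⟩ := hr₂ i
        have := ofDyadic_le_iff.1 (le_trans hX.2 h)
        omega

/-! ### Simplicity -/

/-- If a dyadic rational fits between the options of `G`, then `G` is equal to a dyadic rational
with at most the same denominator. -/
theorem exists_eqv_ofDyadic {G : ShortGame} {m : ℤ} {k : ℕ}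
    (hl : ∀ i, ¬ Le (ofDyadic m k) (G.left i)) (hr : ∀ j, ¬ Le (G.right j) (ofDyadic m k)) :
    ∃ n, Eqv G (ofDyadic n k) := by
  suffices h : ∀ b m, (ofDyadic m k).birthday = b → (∀ i, ¬ Le (ofDyadic m k) (G.left i)) →
      (∀ j, ¬ Le (G.right j) (ofDyadic m k)) → ∃ n, Eqv G (ofDyadic n k) from h _ m rfl hl hr
  intro b
  induction b using Nat.strong_induction_on with
  | _ b ih =>
    rintro m rfl hl hr
    by_cases h₁ : Le G (ofDyadic m k)
    · by_cases h₂ : Le (ofDyadic m k) G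
      · exact ⟨m, h₁, h₂⟩
      · rw [le_iff] at h₂
        simp only [hr, not_false_eq_true, implies_true, and_true, not_forall, not_not] at h₂
        obtain ⟨i, hi⟩ := h₂
        obtain ⟨n, hn, h⟩ := ofDyadic_left m k i
        have hb := birthday_left_lt _ i
        rw [h] at hi hb
        -- A left option of the candidate that is ≥ G also fits between the options of G. It is
        -- simpler and on the same grid, so the descent ends at the value of G.
        exact ih _ hb n rfl (left_not_ge hi)
          fun j hj => hr j (le_trans hj (ofDyadic_le_iff.2 hn.le))
    · rw [le_iff] at h₁
      simp only [hl, not_false_eq_true, implies_true, true_and, not_forall, not_not] at h₁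
      obtain ⟨i, hi⟩ := h₁
      obtain ⟨n, hn, h⟩ := ofDyadic_right m k i
      have hb := birthday_right_lt _ i
      rw [h] at hi hb
      exact ih _ hb n rfl (fun j hj => hl j (le_trans (ofDyadic_le_iff.2 (le_of_lt hn)) hj))
        (right_not_le hi)

/-- If G ≤ x failed through a right option of x that is ≤ G, that option would fit between the
options of G, putting G on the grid. So away from the grid only the left options of G matter. -/
theorem le_ofDyadic_iff {G : ShortGame} {k : ℕ} (hG : ¬ ∃ n, Eqv G (ofDyadic n k)) {m : ℤ} :
    Le G (ofDyadic m k) ↔ ∀ i, ¬ Le (ofDyadic m k) (G.left i) := by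
  refine ⟨left_not_ge, fun hl => ?_⟩
  by_contra h
  rw [le_iff] at h
  simp only [hl, not_false_eq_true, implies_true, true_and, not_forall, not_not] at h
  obtain ⟨j, hj⟩ := h
  obtain ⟨n, hn, h⟩ := ofDyadic_right m k j
  rw [h] at hj
  exact hG (exists_eqv_ofDyadic
    (fun i hi => hl i (le_trans (ofDyadic_le_iff.2 (le_of_lt hn)) hi)) (right_not_le hj))

theorem ofDyadic_le_iff_right {G : ShortGame} {k : ℕ} (hG : ¬ ∃ n, Eqv G (ofDyadic n k)) {m : ℤ} :
    Le (ofDyadic m k) G ↔ ∀ j, ¬ Le (G.right j) (ofDyadic m k) := by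
  refine ⟨right_not_le, fun hr => ?_⟩
  by_contra h
  rw [le_iff] at h
  simp only [hr, not_false_eq_true, implies_true, and_true, not_forall, not_not] at h
  obtain ⟨i, hi⟩ := h
  obtain ⟨n, hn, h⟩ := ofDyadic_left m k i
  rw [h] at hi
  exact hG (exists_eqv_ofDyadic (left_not_ge hi)
    fun j hj => hr j (le_trans hj (ofDyadic_le_iff.2 hn.le)))

theorem le_ofDyadic_birthday (G : ShortGame) : Le G (ofDyadic G.birthday 0) := by
  suffices h : ∀ n (G : ShortGame), G.birthday = n → Le G (ofDyadic n 0) from h _ G rfl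
  intro n
  induction n using Nat.strong_induction_on with
  | _ n ih =>
    rintro G rfl
    rw [le_iff]
    refine ⟨fun i h => ?_, fun j => (ofDyadic_zero_right_nonneg (by omega) j).elim⟩
    have hb := G.birthday_left_lt i
    have := ofDyadic_le_iff.1 (le_trans h (ih _ hb _ rfl))
    omega

theorem ofDyadic_neg_birthday_le (G : ShortGame) : Le (ofDyadic (-G.birthday) 0) G := by
  suffices h : ∀ n (G : ShortGame), G.birthday = n → Le (ofDyadic (-n) 0) G from h _ G rfl
  intro n
  induction n using Nat.strong_induction_on with
  | _ n ih =>
    rintro G rfl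
    rw [le_iff]
    refine ⟨fun j => (ofDyadic_zero_left_nonpos (by omega) j).elim, fun i h => ?_⟩
    have hb := G.birthday_right_lt i
    have := ofDyadic_le_iff.1 (le_trans (ih _ hb _ rfl) h)
    omega

/-- Without left options, a sufficiently negative integer fits between the options of G, so G would
be an integer. -/
theorem numLeft_pos {G : ShortGame} (hG : ¬ G.IsInteger) : 0 < G.numLeft := by
  by_contra! h
  refine hG (exists_eqv_ofDyadic (m := -G.birthday) (k := 0)
    (fun i => absurd i.2 (by omega)) fun j hj => ?_)
  have hb := G.birthday_right_lt j
  have := ofDyadic_le_iff.1 (le_trans (ofDyadic_neg_birthday_le _) hj)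
  omega

theorem numRight_pos {G : ShortGame} (hG : ¬ G.IsInteger) : 0 < G.numRight := by
  by_contra! h
  refine hG (exists_eqv_ofDyadic (m := G.birthday) (k := 0)
    (fun i hi => ?_) fun j => absurd j.2 (by omega))
  have hb := G.birthday_left_lt i
  have := ofDyadic_le_iff.1 (le_trans hi (le_ofDyadic_birthday _))
  omega

end ShortGame

/-! ### Dyadic rationals on a common grid -/

/-- The dyadic rational `m / 2 ^ k`. -/
def dyadic (m : ℤ) (k : ℕ) : DyadicRationals := ⟨(m : ℚ) / 2 ^ k, m, k, rfl⟩

theorem exists_eq_dyadic (x : DyadicRationals) : ∃ m k, x = dyadic m k := by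
  obtain ⟨_, m, k, rfl⟩ := x
  exact ⟨m, k, rfl⟩

theorem dyadic_le_iff {m n : ℤ} {k : ℕ} : dyadic m k ≤ dyadic n k ↔ m ≤ n := by
  rw [← Subtype.coe_le_coe]
  simp only [dyadic]
  rw [div_le_div_iff_of_pos_right (by positivity)]
  exact_mod_cast Iff.rfl

theorem dyadic_lt_iff {m n : ℤ} {k : ℕ} : dyadic m k < dyadic n k ↔ m < n := by
  rw [← not_le, dyadic_le_iff, not_le]

theorem dyadic_add (m n : ℤ) (k : ℕ) : dyadic (m + n) k = dyadic m k + dyadic n k := by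
  apply Subtype.ext
  simp only [dyadic, Subring.coe_add]
  push_cast
  ring

theorem dyadic_neg (m : ℤ) (k : ℕ) : dyadic (-m) k = -dyadic m k := by
  apply Subtype.ext
  simp only [dyadic, Subring.coe_neg]
  push_cast
  ring

theorem dyadic_zero (k : ℕ) : dyadic 0 k = 0 := by
  apply Subtype.ext
  simp [dyadic]

theorem dyadic_two_mul (m : ℤ) (k : ℕ) : dyadic (2 * m) (k + 1) = dyadic m k := by
  apply Subtype.ext
  simp only [dyadic]
  push_cast
  rw [pow_succ]
  field_simp

theorem dyadic_mul_pow (m : ℤ) (k j : ℕ) : dyadic (m * 2 ^ j) (k + j) = dyadic m k := by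
  apply Subtype.ext
  simp only [dyadic]
  push_cast
  rw [pow_add]
  field_simp

theorem exists_dyadic_eq {m : ℤ} {k j : ℕ} (h : k ≤ j) :
    dyadic m k = dyadic (m * 2 ^ (j - k)) j := by
  conv_rhs => rw [← Nat.add_sub_cancel' h]
  simp [dyadic_mul_pow]

theorem dyadic_one_pos (k : ℕ) : 0 < dyadic 1 k := by
  rw [← dyadic_zero k, dyadic_lt_iff]
  exact one_pos

theorem exists_lt_dyadic (x : DyadicRationals) (k : ℕ) : ∃ m, x < dyadic m k := by
  obtain ⟨m, l, rfl⟩ := exists_eq_dyadic x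
  -- This is the integer |m| + 1, written on grid k.
  refine ⟨(|m| + 1) * 2 ^ k, ?_⟩
  have := dyadic_mul_pow (|m| + 1) 0 k
  rw [zero_add] at this
  rw [this, exists_dyadic_eq (Nat.zero_le l), dyadic_lt_iff]
  have h1 : (1 : ℤ) ≤ 2 ^ (l - 0) := one_le_pow₀ (by norm_num)
  have h2 := le_abs_self m
  have h3 := abs_nonneg m
  nlinarith

/-! ### Walls with slopes 0 and -1, and their crossings -/

namespace ShortGame

theorem exists_maxOver_eq {n : ℕ} (hn : 0 < n) (f : Fin n → DyadicRationals) :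
    ∃ i, maxOver f = f i := by
  have h : (Finset.univ : Finset (Fin n)).Nonempty := ⟨⟨0, hn⟩, Finset.mem_univ _⟩
  rw [maxOver, dif_pos h]
  obtain ⟨i, -, hi⟩ := Finset.exists_mem_eq_sup' h f
  exact ⟨i, hi⟩

theorem le_maxOver {n : ℕ} (f : Fin n → DyadicRationals) (i : Fin n) : f i ≤ maxOver f := by
  have h : (Finset.univ : Finset (Fin n)).Nonempty := ⟨i, Finset.mem_univ _⟩
  rw [maxOver, dif_pos h]
  exact Finset.le_sup' f (Finset.mem_univ i)

theorem maxOver_le_iff {n : ℕ} (hn : 0 < n) {f : Fin n → DyadicRationals} {x : DyadicRationals} :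
    maxOver f ≤ x ↔ ∀ i, f i ≤ x := by
  refine ⟨fun h i => (le_maxOver f i).trans h, fun h => ?_⟩
  obtain ⟨i, hi⟩ := exists_maxOver_eq hn f
  exact hi ▸ h i

theorem neg_minOver {n : ℕ} (hn : 0 < n) (f : Fin n → DyadicRationals) :
    -minOver f = maxOver fun i => -f i := by
  have h : (Finset.univ : Finset (Fin n)).Nonempty := ⟨⟨0, hn⟩, Finset.mem_univ _⟩
  apply le_antisymm
  · rw [minOver, dif_pos h]
    obtain ⟨i, -, hi⟩ := Finset.exists_mem_eq_inf' h f
    rw [hi]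
    exact le_maxOver (fun i => -f i) i
  · rw [maxOver_le_iff hn]
    intro i
    rw [minOver, dif_pos h]
    exact neg_le_neg (Finset.inf'_le f (Finset.mem_univ i))

/-- The function `f` maps `2 ^ (-k) ℤ` to itself. -/
def GridStable (f : DyadicRationals → DyadicRationals) (k : ℕ) : Prop :=
  ∀ m, ∃ n, f (dyadic m k) = dyadic n k

/-- The common properties of left walls, negated right walls and their scaffolds: the slopes are
`0` and `-1`, with a dyadic bound on the denominators of the breakpoints. -/
structure IsWall (f : DyadicRationals → DyadicRationals) : Prop where
  anti : Antitone f
  mono : Monotone fun t => f t + t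
  grid : ∃ k, GridStable f k

/-- Over one grid interval f drops by 0 or by a full step. By the slope bounds f is then constant or
of slope -1 there, so its value at the midpoint is on the refined grid. -/
theorem GridStable.succ {f : DyadicRationals → DyadicRationals} (hf : IsWall f) {k : ℕ}
    (h : GridStable f k) : GridStable f (k + 1) := by
  intro m
  obtain ⟨a, rfl | rfl⟩ := Int.even_or_odd' m
  · obtain ⟨n, hn⟩ := h a
    exact ⟨2 * n, by rw [dyadic_two_mul, hn, dyadic_two_mul]⟩
  · obtain ⟨p, hp⟩ := h a
    obtain ⟨q, hq⟩ := h (a + 1)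
    rw [← dyadic_two_mul, ← dyadic_two_mul p] at hp
    rw [← dyadic_two_mul, ← dyadic_two_mul q] at hq
    have h₁ : dyadic (2 * a) (k + 1) ≤ dyadic (2 * a + 1) (k + 1) :=
      dyadic_le_iff.2 (by omega)
    have h₂ : dyadic (2 * a + 1) (k + 1) ≤ dyadic (2 * (a + 1)) (k + 1) :=
      dyadic_le_iff.2 (by omega)
    have a₁ := hf.anti h₁
    have a₂ := hf.anti h₂
    have m₁ := hf.mono h₁
    have m₂ := hf.mono h₂
    have m₃ := hf.mono (h₁.trans h₂)
    simp only [hp, hq] at a₁ a₂ m₁ m₂ m₃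
    have e₁ := dyadic_add (2 * a) 1 (k + 1)
    have e₂ : dyadic (2 * (a + 1)) (k + 1) =
        dyadic (2 * a) (k + 1) + dyadic 1 (k + 1) + dyadic 1 (k + 1) := by
      rw [← dyadic_add, ← dyadic_add]; congr 1; ring
    have hpq : q ≤ p := by
      have := dyadic_le_iff.1 (a₂.trans a₁); omega
    have hpq' : p ≤ q + 1 := by
      rw [← dyadic_add, ← dyadic_add, dyadic_le_iff] at m₃; omega
    obtain rfl | rfl : p = q ∨ p = q + 1 := by omega
    · exact ⟨2 * p, le_antisymm a₁ a₂⟩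
    · have e₃ := dyadic_add (2 * q) 1 (k + 1)
      have e₄ : dyadic (2 * (q + 1)) (k + 1) =
          dyadic (2 * q) (k + 1) + dyadic 1 (k + 1) + dyadic 1 (k + 1) := by
        rw [← dyadic_add, ← dyadic_add]; congr 1; ring
      exact ⟨2 * q + 1, by linarith⟩

theorem GridStable.of_le {f : DyadicRationals → DyadicRationals} (hf : IsWall f) {k l : ℕ}
    (h : GridStable f k) (hkl : k ≤ l) : GridStable f l := by
  induction l, hkl using Nat.le_induction with
  | base => exact h
  | succ l _ ih => exact ih.succ hf

theorem IsWall.const (x : DyadicRationals) : IsWall fun _ => x := by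
  obtain ⟨m, k, rfl⟩ := exists_eq_dyadic x
  exact ⟨antitone_const, fun s t h => by simpa using h, k, fun _ => ⟨m, rfl⟩⟩

/-- Truncating a wall by a mast. -/
theorem IsWall.comp_min {f : DyadicRationals → DyadicRationals} (hf : IsWall f)
    (τ : DyadicRationals) : IsWall fun t => f (min t τ) := by
  refine ⟨fun s t h => hf.anti (min_le_min_right τ h), fun s t h => ?_, ?_⟩
  · have h₁ : min s τ ≤ min t τ := min_le_min_right τ h
    have h₂ := hf.mono h₁
    simp only at h₂ ⊢
    have h₃ : min t τ - min s τ ≤ t - s := by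
      rcases le_total s τ with hs | hs <;> rcases le_total t τ with ht | ht <;>
        simp only [hs, ht, min_eq_left, min_eq_right] <;> linarith
    linarith
  · obtain ⟨k, hk⟩ := hf.grid
    obtain ⟨n, l, rfl⟩ := exists_eq_dyadic τ
    -- The grid must be fine enough to contain the truncation point τ.
    refine ⟨max k l, fun m => ?_⟩
    have h := hk.of_le hf (le_max_left k l)
    rw [exists_dyadic_eq (le_max_right k l)]
    beta_reduce
    rcases min_choice (dyadic m (max k l)) (dyadic (n * 2 ^ (max k l - l)) (max k l)) with h' | h'
    · rw [h']; exact h _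
    · rw [h']; exact h _

/-- The map w ↦ -w - t interchanges the slopes 0 and -1, and maxima preserve them. With w = -ρ it
builds left scaffolds, with w = λ negated right scaffolds. -/
theorem IsWall.maxOver {n : ℕ} (hn : 0 < n) {w : Fin n → DyadicRationals → DyadicRationals}
    (hw : ∀ i, IsWall (w i)) : IsWall fun t => maxOver fun i => -w i t - t := by
  refine ⟨fun s t h => ?_, fun s t h => ?_, ?_⟩
  · simp only [maxOver_le_iff hn]
    intro i
    have h₁ := le_maxOver (fun i => -w i s - s) i
    have h₂ := (hw i).mono h
    simp only at h₁ h₂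
    linarith
  · obtain ⟨i, hi⟩ := exists_maxOver_eq hn (fun i => -w i s - s)
    have h₁ := le_maxOver (fun i => -w i t - t) i
    have h₂ := (hw i).anti h
    simp only at h₁ ⊢
    rw [hi]
    linarith
  · choose k hk using fun i => (hw i).grid
    refine ⟨Finset.univ.sup k, fun m => ?_⟩
    obtain ⟨i, hi⟩ := exists_maxOver_eq hn
      (fun i => -w i (dyadic m (Finset.univ.sup k)) - dyadic m (Finset.univ.sup k))
    obtain ⟨p, hp⟩ := (hk i).of_le (hw i) (Finset.le_sup (Finset.mem_univ i)) m
    exact ⟨-p + -m, by beta_reduce; rw [hi, hp, dyadic_add, dyadic_neg, dyadic_neg, sub_eq_add_neg]⟩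

/-- Scaffolds that cross have a least crossing point. -/
theorem IsWall.exists_isLeast_crossing {f g : DyadicRationals → DyadicRationals} (hf : IsWall f)
    (hg : IsWall fun t => -g t) {s t : DyadicRationals} (hs : g s < f s) (ht : f t ≤ g t) :
    ∃ τ, IsLeast {t | f t = g t} τ := by
  have hanti : ∀ {x y}, x ≤ y → f y - g y ≤ f x - g x := fun h => by
    have h₁ := hf.anti h
    have h₂ := hg.anti h
    linarith
  obtain ⟨k₁, hk₁⟩ := hf.grid
  obtain ⟨k₂, hk₂⟩ := hg.grid
  set k := max k₁ k₂ with hk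
  have hfk : GridStable f k := hk₁.of_le hf (le_max_left _ _)
  have hgk : GridStable (fun t => -g t) k := hk₂.of_le hg (le_max_right _ _)
  clear_value k
  -- On a grid stable for both functions, take the first point where f ≤ g; every crossing lies
  -- after its predecessor.
  obtain ⟨m, hm, hmin⟩ : ∃ m, f (dyadic m k) ≤ g (dyadic m k) ∧
      ∀ n, f (dyadic n k) ≤ g (dyadic n k) → m ≤ n := by
    refine Int.exists_least_of_bdd ?_ ?_
    · obtain ⟨b, hb⟩ := exists_lt_dyadic (-s) k
      refine ⟨-b, fun z hz => ?_⟩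
      by_contra! hlt
      rw [← dyadic_lt_iff (k := k), dyadic_neg] at hlt
      have := hanti (show dyadic z k ≤ s by linarith)
      linarith
    · obtain ⟨b, hb⟩ := exists_lt_dyadic t k
      exact ⟨b, by have := hanti hb.le; linarith⟩
  have hm' : g (dyadic (m - 1) k) < f (dyadic (m - 1) k) := by
    by_contra! h
    have := hmin _ h
    omega
  have hh := dyadic_one_pos k
  have ea := dyadic_add (m - 1) 1 k
  rw [sub_add_cancel] at ea
  have hle : dyadic (m - 1) k ≤ dyadic m k := by linarith
  obtain ⟨p, hp⟩ := hfk (m - 1)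
  obtain ⟨p', hp'⟩ := hfk m
  obtain ⟨q, hq⟩ := hgk (m - 1)
  obtain ⟨q', hq'⟩ := hgk m
  simp only at hq hq'
  have fa := hf.anti hle
  have fm := hf.mono hle
  have ga := hg.anti hle
  have gm := hg.mono hle
  simp only at fm ga gm
  have hp₁ : p' ≤ p := by rwa [hp, hp', dyadic_le_iff] at fa
  have hq₁ : q' ≤ q := by rwa [hq, hq', dyadic_le_iff] at ga
  have hp₂ : p ≤ p' + 1 := by
    rw [hp, hp', ea, ← dyadic_add, ← dyadic_add, ← dyadic_add, dyadic_le_iff] at fm; omega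
  have hq₂ : q ≤ q' + 1 := by
    rw [hq, hq', ea, ← dyadic_add, ← dyadic_add, ← dyadic_add, dyadic_le_iff] at gm; omega
  have hpq : 0 < p + q := by
    rw [← dyadic_lt_iff (k := k), dyadic_zero, dyadic_add]; linarith
  have hpq' : p' + q' ≤ 0 := by
    rw [← dyadic_le_iff (k := k), dyadic_zero, dyadic_add]; linarith
  have bound : ∀ t, dyadic (m - 1) k ≤ t →
      f (dyadic (m - 1) k) + dyadic (m - 1) k ≤ f t + t ∧
      -g (dyadic (m - 1) k) + dyadic (m - 1) k ≤ -g t + t :=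
    fun t ht => ⟨hf.mono ht, hg.mono ht⟩
  have bound' : ∀ t, t ≤ dyadic m k → f (dyadic m k) ≤ f t ∧ -g (dyadic m k) ≤ -g t :=
    fun t ht => ⟨hf.anti ht, hg.anti ht⟩
  have below : ∀ t, f t = g t → dyadic (m - 1) k ≤ t := fun t ht => by
    by_contra! hlt
    have := hanti hlt.le
    linarith
  have e₀ := dyadic_zero k
  -- In grid steps, f - g falls from p + q > 0 to p' + q' ≤ 0, while f and -g each drop by 0 or 1.
  -- If it reaches 0 at m, the slopes are constant on the interval and f - g is positive before m.
  by_cases hz : p' + q' = 0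
  · have e₁ : dyadic p' k + dyadic q' k = 0 := by rw [← dyadic_add, hz, e₀]
    refine ⟨dyadic m k, show f _ = g _ by linarith, fun t ht => ?_⟩
    change f t = g t at ht
    by_contra! hlt
    obtain ⟨b₁, b₂⟩ := bound t (below t ht)
    obtain ⟨b₃, b₄⟩ := bound' t hlt.le
    obtain rfl | rfl : p = p' ∨ p = p' + 1 := by omega
    · have e₂ : dyadic q k = dyadic q' k + dyadic 1 k := by
        rw [← dyadic_add]; congr 1; omega
      linarith
    · rw [dyadic_add] at hp
      obtain rfl | rfl : q = q' ∨ q = q' + 1 := by omega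
      · linarith
      · rw [dyadic_add] at hq
        linarith
  -- Otherwise f - g falls from one step to minus one step with slope -2, so it vanishes exactly at
  -- the midpoint.
  · obtain rfl : p = p' + 1 := by omega
    obtain rfl : q = q' + 1 := by omega
    have e₁ : dyadic p' k + dyadic q' k = -dyadic 1 k := by
      rw [← dyadic_add, ← dyadic_neg]; congr 1; omega
    rw [dyadic_add] at hp hq
    have e₂ : dyadic 1 k = dyadic 1 (k + 1) + dyadic 1 (k + 1) := by
      rw [← dyadic_add, ← dyadic_two_mul]; rfl
    have hh' := dyadic_one_pos (k + 1)
    refine ⟨dyadic (m - 1) k + dyadic 1 (k + 1), ?_, fun t ht => ?_⟩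
    · obtain ⟨b₁, b₂⟩ := bound (dyadic (m - 1) k + dyadic 1 (k + 1)) (by linarith)
      have hlast : dyadic (m - 1) k + dyadic 1 (k + 1) ≤ dyadic m k := by linarith
      have b₃ := hf.mono hlast
      have b₄ := hg.mono hlast
      simp only at b₃ b₄
      change f _ = g _
      linarith
    · change f t = g t at ht
      obtain ⟨b₁, b₂⟩ := bound t (below t ht)
      by_contra! hlt
      linarith

/-- The mast amounts to evaluating both scaffolds at min t τ, which makes walls an instance of
`IsWall.comp_min`. -/
theorem Thermograph.ofScaffolds_eq {f g : DyadicRationals → DyadicRationals} {τ : DyadicRationals}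
    (h : IsLeast {t | f t = g t} τ) :
    Thermograph.ofScaffolds f g =
      ⟨fun t => f (min t τ), fun t => g (min t τ), (τ : WithBot DyadicRationals)⟩ := by
  have hex : ∃ τ, IsLeast {t | f t = g t} τ := ⟨τ, h⟩
  have hτ : hex.choose = τ := hex.choose_spec.unique h
  rw [Thermograph.ofScaffolds, dif_pos hex]
  simp only [hτ, min_def, apply_ite]

end ShortGame

/-! ### Walls at t = -2^(-k) as dyadic roundings -/

namespace ShortGame

theorem ofDyadic_le_ofDyadic_iff {m n : ℤ} {k l : ℕ} :
    Le (ofDyadic m k) (ofDyadic n l) ↔ dyadic m k ≤ dyadic n l := by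
  rw [exists_ofDyadic_eq (m := m) (le_max_left k l), exists_ofDyadic_eq (m := n) (le_max_right k l),
    exists_dyadic_eq (m := m) (le_max_left k l), exists_dyadic_eq (m := n) (le_max_right k l),
    ofDyadic_le_iff, dyadic_le_iff]

theorem Eqv.le_iff_left {G H K : ShortGame} (h : Eqv G H) : Le G K ↔ Le H K :=
  ⟨le_trans h.2, le_trans h.1⟩

theorem Eqv.le_iff_right {G H K : ShortGame} (h : Eqv G H) : Le K G ↔ Le K H :=
  ⟨fun h' => le_trans h' h.1, fun h' => le_trans h' h.2⟩

/-- The walls of `G` are regular, and at `t = -2 ^ (-k)` they are the best upper and lower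
approximations of `G` by elements of `2 ^ (-k) ℤ`. -/
structure WallsApproximate (G : ShortGame) : Prop where
  isWall_left : IsWall G.leftWall
  isWall_right : IsWall fun t => -G.rightWall t
  left_bdd : ∃ C, ∀ t, C ≤ G.leftWall t
  right_bdd : ∃ C, ∀ t, G.rightWall t ≤ C
  le_iff : ∀ m k, Le G (ofDyadic m k) ↔ G.leftWall (dyadic (-1) k) ≤ dyadic m k
  ge_iff : ∀ m k, Le (ofDyadic m k) G ↔ dyadic m k ≤ G.rightWall (dyadic (-1) k)
  left_grid : ∀ k, ∃ n, G.leftWall (dyadic (-1) k) = dyadic n k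
  right_grid : ∀ k, ∃ n, G.rightWall (dyadic (-1) k) = dyadic n k

theorem intCast_eq_dyadic (n : ℤ) : (n : DyadicRationals) = dyadic n 0 := by
  apply Subtype.ext
  simp [dyadic]

theorem exists_thermograph_of_isInteger {G : ShortGame} (h : G.IsInteger) :
    ∃ n : ℤ, Eqv G (ofDyadic n 0) ∧ G.thermograph =
      ⟨fun _ => dyadic n 0, fun _ => dyadic n 0, ⊥⟩ := by
  refine ⟨h.choose, h.choose_spec, ?_⟩
  cases G with
  | mk L R => rw [thermograph, dif_pos h, intCast_eq_dyadic]

theorem WallsApproximate.of_isInteger {G : ShortGame} (h : G.IsInteger) : WallsApproximate G := by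
  obtain ⟨n, hn, hth⟩ := exists_thermograph_of_isInteger h
  have hl : G.leftWall = fun _ => dyadic n 0 := by funext t; rw [leftWall, hth]
  have hr : G.rightWall = fun _ => dyadic n 0 := by funext t; rw [rightWall, hth]
  refine ⟨?_, ?_, ⟨dyadic n 0, fun t => by rw [hl]⟩, ⟨dyadic n 0, fun t => by rw [hr]⟩,
    fun m k => ?_, fun m k => ?_, fun k => ⟨n * 2 ^ k, ?_⟩,
    fun k => ⟨n * 2 ^ k, ?_⟩⟩
  · rw [hl]; exact IsWall.const _
  · rw [hr]; exact IsWall.const _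
  · rw [hl, hn.le_iff_left, ofDyadic_le_ofDyadic_iff]
  · rw [hr, hn.le_iff_right, ofDyadic_le_ofDyadic_iff]
  · rw [hl]; exact exists_dyadic_eq (Nat.zero_le k)
  · rw [hr]; exact exists_dyadic_eq (Nat.zero_le k)

section Step

variable {G : ShortGame} (hG : ¬ G.IsInteger) (hL : ∀ i, WallsApproximate (G.left i))
  (hR : ∀ j, WallsApproximate (G.right j))

/-- Subtracting t = -2^(-k) adds one grid step, which turns a strict inequality of grid points into
a weak one. This is where the tax matches the order of games. -/
theorem dyadic_sub_neg_one_le_iff {n m : ℤ} {k : ℕ} :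
    dyadic n k - dyadic (-1) k ≤ dyadic m k ↔ ¬ dyadic m k ≤ dyadic n k := by
  rw [sub_eq_add_neg, ← dyadic_neg, ← dyadic_add, dyadic_le_iff, dyadic_le_iff]
  omega

theorem le_dyadic_add_neg_one_iff {n m : ℤ} {k : ℕ} :
    dyadic m k ≤ dyadic n k + dyadic (-1) k ↔ ¬ dyadic n k ≤ dyadic m k := by
  rw [← dyadic_add, dyadic_le_iff, dyadic_le_iff]
  omega

theorem neg_rightScaffold (h : 0 < G.numRight) (t : DyadicRationals) :
    -G.rightScaffold t = maxOver fun j => -(G.right j).leftWall t - t := by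
  rw [rightScaffold, neg_minOver h]
  congr 1
  funext j
  ring

include hG hL in
theorem isWall_leftScaffold : IsWall G.leftScaffold := by
  have := IsWall.maxOver (numLeft_pos hG) fun i => (hL i).isWall_right
  simp only [_root_.neg_neg] at this
  exact this

include hG hR in
theorem isWall_rightScaffold : IsWall fun t => -G.rightScaffold t := by
  simp only [neg_rightScaffold (numRight_pos hG)]
  exact IsWall.maxOver (numRight_pos hG) fun i => (hR i).isWall_left

include hG hL in
theorem leftScaffold_le_iff (m : ℤ) (k : ℕ) :
    G.leftScaffold (dyadic (-1) k) ≤ dyadic m k ↔ ∀ i, ¬ Le (ofDyadic m k) (G.left i) := by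
  rw [leftScaffold, maxOver_le_iff (numLeft_pos hG)]
  refine forall_congr' fun i => ?_
  rw [(hL i).ge_iff]
  obtain ⟨n, hn⟩ := (hL i).right_grid k
  rw [hn, dyadic_sub_neg_one_le_iff]

include hG hR in
theorem le_rightScaffold_iff (m : ℤ) (k : ℕ) :
    dyadic m k ≤ G.rightScaffold (dyadic (-1) k) ↔ ∀ j, ¬ Le (G.right j) (ofDyadic m k) := by
  rw [← neg_le_neg_iff, neg_rightScaffold (numRight_pos hG), maxOver_le_iff (numRight_pos hG)]
  refine forall_congr' fun j => ?_
  rw [(hR j).le_iff]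
  obtain ⟨n, hn⟩ := (hR j).left_grid k
  rw [hn, ← le_dyadic_add_neg_one_iff, ← neg_le_neg_iff, _root_.neg_neg, neg_sub, sub_neg_eq_add,
    add_comm]

include hG hL in
theorem leftScaffold_grid (k : ℕ) : ∃ n, G.leftScaffold (dyadic (-1) k) = dyadic n k := by
  obtain ⟨i, hi⟩ := exists_maxOver_eq (numLeft_pos hG)
    (fun i => (G.left i).rightWall (dyadic (-1) k) - dyadic (-1) k)
  obtain ⟨n, hn⟩ := (hL i).right_grid k
  exact ⟨n + 1, by rw [leftScaffold, hi, hn, sub_eq_add_neg, ← dyadic_neg, ← dyadic_add]; rfl⟩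

include hG hR in
theorem rightScaffold_grid (k : ℕ) : ∃ n, G.rightScaffold (dyadic (-1) k) = dyadic n k := by
  obtain ⟨j, hj⟩ := exists_maxOver_eq (numRight_pos hG)
    (fun j => -(G.right j).leftWall (dyadic (-1) k) - dyadic (-1) k)
  obtain ⟨n, hn⟩ := (hR j).left_grid k
  refine ⟨n + -1, ?_⟩
  rw [← neg_inj, neg_rightScaffold (numRight_pos hG), hj, hn, dyadic_add]
  ring

include hG hL in
theorem le_iff_leftScaffold_le {k : ℕ} (hk : ¬ ∃ n, Eqv G (ofDyadic n k)) (m : ℤ) :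
    Le G (ofDyadic m k) ↔ G.leftScaffold (dyadic (-1) k) ≤ dyadic m k := by
  rw [le_ofDyadic_iff hk, leftScaffold_le_iff hG hL]

include hG hR in
theorem ge_iff_le_rightScaffold {k : ℕ} (hk : ¬ ∃ n, Eqv G (ofDyadic n k)) (m : ℤ) :
    Le (ofDyadic m k) G ↔ dyadic m k ≤ G.rightScaffold (dyadic (-1) k) := by
  rw [ofDyadic_le_iff_right hk, le_rightScaffold_iff hG hR]

include hG hL hR in
-- Both scaffolds take grid values here and enclose G; if they agreed, G would equal that grid
-- point.
theorem rightScaffold_lt_leftScaffold {k : ℕ} (hk : ¬ ∃ n, Eqv G (ofDyadic n k)) :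
    G.rightScaffold (dyadic (-1) k) < G.leftScaffold (dyadic (-1) k) := by
  obtain ⟨p, hp⟩ := leftScaffold_grid hG hL k
  obtain ⟨q, hq⟩ := rightScaffold_grid hG hR k
  have h₁ := (le_iff_leftScaffold_le hG hL hk p).2 hp.le
  have h₂ := (ge_iff_le_rightScaffold hG hR hk q).2 hq.ge
  rw [hp, hq, dyadic_lt_iff]
  refine lt_of_le_of_ne (ofDyadic_le_iff.1 (le_trans h₂ h₁)) ?_
  rintro rfl
  exact hk ⟨q, h₁, h₂⟩

include hG hL hR in
theorem exists_isLeast_crossing :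
    ∃ τ, IsLeast {t | G.leftScaffold t = G.rightScaffold t} τ := by
  choose a ha using fun i => (hL i).right_bdd
  choose b hb using fun j => (hR j).left_bdd
  obtain ⟨A, hA⟩ : ∃ A, A = maxOver a := ⟨_, rfl⟩
  obtain ⟨B, hB⟩ : ∃ B, B = minOver b := ⟨_, rfl⟩
  have hB' := neg_minOver (numRight_pos hG) b
  -- The scaffolds are strictly crossed at t = -1, since G is not an integer. For large t the bounds
  -- A - t and B + t force them to pass each other.
  refine (isWall_leftScaffold hG hL).exists_isLeast_crossing (isWall_rightScaffold hG hR)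
    (rightScaffold_lt_leftScaffold hG hL hR (k := 0) hG) (t := max 0 (A - B)) ?_
  have h₁ : G.leftScaffold (max 0 (A - B)) ≤ A - max 0 (A - B) := by
    rw [leftScaffold, maxOver_le_iff (numLeft_pos hG), hA]
    exact fun i => sub_le_sub_right ((ha i _).trans (le_maxOver a i)) _
  have h₂ : -G.rightScaffold (max 0 (A - B)) ≤ -B - max 0 (A - B) := by
    rw [neg_rightScaffold (numRight_pos hG), maxOver_le_iff (numRight_pos hG), hB, hB']
    exact fun j => sub_le_sub_right
      ((neg_le_neg (hb j _)).trans (le_maxOver (fun j => -b j) j)) _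
  have h₃ := le_max_left 0 (A - B)
  have h₄ := le_max_right 0 (A - B)
  linarith

variable {τ : DyadicRationals} (hτ : IsLeast {t | G.leftScaffold t = G.rightScaffold t} τ)

include hG hL hR in
theorem scaffold_sub_antitone : Antitone fun t => G.leftScaffold t - G.rightScaffold t := by
  intro s t h
  have h₁ := (isWall_leftScaffold hG hL).anti h
  have h₂ := (isWall_rightScaffold hG hR).anti h
  linarith

include hG hL hR hτ in
theorem lt_of_isLeast_crossing {k : ℕ} (hk : ¬ ∃ n, Eqv G (ofDyadic n k)) :
    dyadic (-1) k < τ := by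
  by_contra! h
  have h₁ := rightScaffold_lt_leftScaffold hG hL hR hk
  have h₂ := scaffold_sub_antitone hG hL hR h
  have h₃ : G.leftScaffold τ = G.rightScaffold τ := hτ.1
  linarith

include hG hL hR hτ in
/-- A number that is not an integer has its value on the mast, which begins below `0`. -/
theorem mast_of_eqv_ofDyadic {n : ℤ} {k : ℕ} (h : Eqv G (ofDyadic n k)) :
    τ ≤ dyadic (-1) k ∧ G.leftScaffold τ = dyadic n k := by
  classical
  -- Work with the coarsest grid containing the value of G. It is not ℤ, and on the next coarser
  -- grid the off-grid description applies.
  have hex : ∃ j n, Eqv G (ofDyadic n j) := ⟨k, n, h⟩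
  obtain ⟨j, hj⟩ : ∃ j, j = Nat.find hex := ⟨_, rfl⟩
  obtain ⟨x, hx⟩ : ∃ x, Eqv G (ofDyadic x j) := hj ▸ Nat.find_spec hex
  have hjk : j ≤ k := hj ▸ Nat.find_min' hex ⟨n, h⟩
  have hnot : ∀ l < j, ¬ ∃ n, Eqv G (ofDyadic n l) := fun l hl => Nat.find_min hex (hj ▸ hl)
  have hxn : dyadic x j = dyadic n k :=
    le_antisymm (ofDyadic_le_ofDyadic_iff.1 (le_trans hx.2 h.1))
      (ofDyadic_le_ofDyadic_iff.1 (le_trans h.2 hx.1))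
  rw [← hxn]
  obtain _ | j := j
  · exact absurd ⟨x, hx⟩ hG
  have hk := hnot j (by omega)
  have l₁ := (leftScaffold_le_iff hG hL x (j + 1)).2 (left_not_ge hx.1)
  have r₁ := (le_rightScaffold_iff hG hR x (j + 1)).2 (right_not_le hx.2)
  obtain ⟨p, hp⟩ := leftScaffold_grid hG hL j
  obtain ⟨q, hq⟩ := rightScaffold_grid hG hR j
  have hp' := (le_iff_leftScaffold_le hG hL hk p).2 hp.le
  have hq' := (ge_iff_le_rightScaffold hG hR hk q).2 hq.ge
  -- The coarse roundings p and q differ from the value x by at least one fine step, because x is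
  -- not on the coarse grid.
  have hxp : x + 1 ≤ 2 * p := by
    refine Int.add_one_le_of_lt (lt_of_le_of_ne ?_ ?_)
    · rw [← ofDyadic_le_iff (k := j + 1), ofDyadic_two_mul]
      exact le_trans hx.2 hp'
    · rintro rfl
      exact hk ⟨p, by rwa [ofDyadic_two_mul] at hx⟩
  have hqx : 2 * q + 1 ≤ x := by
    refine Int.add_one_le_of_lt (lt_of_le_of_ne ?_ ?_)
    · rw [← ofDyadic_le_iff (k := j + 1), ofDyadic_two_mul]
      exact le_trans hq' hx.1
    · rintro rfl
      exact hk ⟨q, by rwa [ofDyadic_two_mul] at hx⟩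
  have hxp' := dyadic_le_iff (k := j + 1).2 hxp
  have hqx' := dyadic_le_iff (k := j + 1).2 hqx
  rw [dyadic_add, dyadic_two_mul] at hxp' hqx'
  have hh := dyadic_one_pos (j + 1)
  have e₁ : dyadic (-1) j = dyadic (-1) (j + 1) + dyadic (-1) (j + 1) := by
    rw [← dyadic_add, ← dyadic_two_mul]; rfl
  have e₂ := dyadic_neg 1 (j + 1)
  have hle : dyadic (-1) j ≤ dyadic (-1) (j + 1) := by linarith
  -- Going up from -2^(-j) to -2^(-(j+1)) takes one fine step, in which each scaffold moves by at
  -- most that much. So they cannot pass x, while `l₁` and `r₁` make them reach it; both equal x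
  -- there.
  have l₂ := (isWall_leftScaffold hG hL).mono hle
  have r₂ := (isWall_rightScaffold hG hR).mono hle
  simp only at l₂ r₂
  have hτj : τ ≤ dyadic (-1) (j + 1) := hτ.2 (show _ = _ by linarith)
  -- At the earlier point τ the left scaffold is ≥ x and the right one ≤ x, so their common value is
  -- x.
  have l₃ := (isWall_leftScaffold hG hL).anti hτj
  have r₃ := (isWall_rightScaffold hG hR).anti hτj
  have hτ' : G.leftScaffold τ = G.rightScaffold τ := hτ.1
  refine ⟨hτj.trans ?_, by linarith⟩
  rw [exists_dyadic_eq hjk, dyadic_le_iff]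
  have : (1 : ℤ) ≤ 2 ^ (k - (j + 1)) := one_le_pow₀ (by norm_num)
  linarith

include hG hτ in
theorem leftWall_eq (t : DyadicRationals) : G.leftWall t = G.leftScaffold (min t τ) := by
  rw [leftWall, thermograph_of_not_isInteger G hG, Thermograph.ofScaffolds_eq hτ]

include hG hτ in
theorem rightWall_eq (t : DyadicRationals) : G.rightWall t = G.rightScaffold (min t τ) := by
  rw [rightWall, thermograph_of_not_isInteger G hG, Thermograph.ofScaffolds_eq hτ]

include hG hτ in
theorem temperature_eq : G.temperature = τ := by
  rw [temperature, thermograph_of_not_isInteger G hG, Thermograph.ofScaffolds_eq hτ]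

include hG hL hR in
theorem WallsApproximate.of_options : WallsApproximate G := by
  obtain ⟨τ, hτ⟩ := exists_isLeast_crossing hG hL hR
  have hτ' : G.leftScaffold τ = G.rightScaffold τ := hτ.1
  have hfl := funext (leftWall_eq hG hτ)
  have hfr := funext (rightWall_eq hG hτ)
  have hwl := isWall_leftScaffold hG hL
  have hwr := isWall_rightScaffold hG hR
  -- Either G is on the grid and t = -2^(-k) lies on the mast, or it is off the grid and t lies
  -- below τ, where walls and scaffolds agree.
  have hval : ∀ k, (∃ n, Eqv G (ofDyadic n k) ∧ G.leftWall (dyadic (-1) k) = dyadic n k ∧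
      G.rightWall (dyadic (-1) k) = dyadic n k) ∨ ((¬ ∃ n, Eqv G (ofDyadic n k)) ∧
      G.leftWall (dyadic (-1) k) = G.leftScaffold (dyadic (-1) k) ∧
      G.rightWall (dyadic (-1) k) = G.rightScaffold (dyadic (-1) k)) := by
    intro k
    by_cases hk : ∃ n, Eqv G (ofDyadic n k)
    · obtain ⟨n, hn⟩ := hk
      obtain ⟨h₁, h₂⟩ := mast_of_eqv_ofDyadic hG hL hR hτ hn
      exact Or.inl ⟨n, hn, by simp only [hfl, min_eq_right h₁, h₂],
        by simp only [hfr, min_eq_right h₁, ← hτ', h₂]⟩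
    · have h := (lt_of_isLeast_crossing hG hL hR hτ hk).le
      exact Or.inr ⟨hk, by simp only [hfl, min_eq_left h], by simp only [hfr, min_eq_left h]⟩
  refine ⟨?_, ?_, ⟨G.leftScaffold τ, fun t => ?_⟩, ⟨G.rightScaffold τ, fun t => ?_⟩,
    fun m k => ?_, fun m k => ?_, fun k => ?_, fun k => ?_⟩
  · rw [hfl]; exact hwl.comp_min τ
  · rw [hfr]; exact hwr.comp_min τ
  · rw [hfl]; exact hwl.anti (min_le_right t τ)
  · rw [hfr]; exact neg_le_neg_iff.1 (hwr.anti (min_le_right t τ))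
  · rcases hval k with ⟨n, hn, h, -⟩ | ⟨hk, h, -⟩
    · rw [h, hn.le_iff_left, ofDyadic_le_ofDyadic_iff]
    · rw [h, le_iff_leftScaffold_le hG hL hk]
  · rcases hval k with ⟨n, hn, -, h⟩ | ⟨hk, -, h⟩
    · rw [h, hn.le_iff_right, ofDyadic_le_ofDyadic_iff]
    · rw [h, ge_iff_le_rightScaffold hG hR hk]
  · rcases hval k with ⟨n, -, h, -⟩ | ⟨-, h, -⟩
    · exact ⟨n, h⟩
    · rw [h]; exact leftScaffold_grid hG hL k
  · rcases hval k with ⟨n, -, -, h⟩ | ⟨-, -, h⟩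
    · exact ⟨n, h⟩
    · rw [h]; exact rightScaffold_grid hG hR k

end Step

theorem wallsApproximate (G : ShortGame) : WallsApproximate G := by
  induction G with
  | mk L R ihL ihR =>
    by_cases h : (mk L R).IsInteger
    · exact .of_isInteger h
    · exact .of_options h ihL ihR

end ShortGame

/-! ### Numberish games and the sign of the temperature -/

theorem nonpos_of_le_dyadic_one {y : DyadicRationals} {k₀ : ℕ} (h : ∀ k ≥ k₀, y ≤ dyadic 1 k) :
    y ≤ 0 := by
  by_contra! hy
  obtain ⟨m, l, rfl⟩ := exists_eq_dyadic y
  rw [← dyadic_zero l, dyadic_lt_iff] at hy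
  have h₁ := h (max k₀ l + 1) (by omega)
  have h₂ : l ≤ max k₀ l + 1 := by omega
  rw [exists_dyadic_eq h₂, dyadic_le_iff] at h₁
  have h₃ : (2 : ℤ) ≤ 2 ^ (max k₀ l + 1 - l) := le_self_pow₀ (by norm_num) (by omega)
  nlinarith

namespace ShortGame

theorem exists_ofDyadic_one_lt {y : ShortGame} (hy : y.IsNumber) (hy₀ : Lt zero y) (k₀ : ℕ) :
    ∃ k ≥ k₀, Lt (ofDyadic 1 k) y := by
  obtain ⟨a, l, ha⟩ := hy
  have ha₀ : 0 < dyadic a l := by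
    by_contra! h
    refine hy₀.2 (le_trans ha.1 (K := ofDyadic 0 0) (ofDyadic_le_ofDyadic_iff.2 ?_))
    rwa [dyadic_zero]
  obtain ⟨k, hk, hlt⟩ : ∃ k ≥ k₀, dyadic 1 k < dyadic a l := by
    by_contra! h
    exact absurd (nonpos_of_le_dyadic_one h) (not_le.2 ha₀)
  exact ⟨k, hk, le_trans (ofDyadic_le_ofDyadic_iff.2 hlt.le) ha.2,
    fun h => not_le.2 hlt (ofDyadic_le_ofDyadic_iff.1 (le_trans ha.2 h))⟩

theorem ofDyadic_one_isNumber (k : ℕ) : (ofDyadic 1 k).IsNumber := ⟨1, k, le_refl _, le_refl _⟩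

theorem zero_lt_ofDyadic_one (k : ℕ) : Lt zero (ofDyadic 1 k) := by
  have h₁ := dyadic_one_pos k
  rw [← dyadic_zero 0] at h₁
  exact ⟨ofDyadic_le_ofDyadic_iff (m := 0) (k := 0).2 h₁.le,
    fun h => not_le.2 h₁ (ofDyadic_le_ofDyadic_iff (n := 0) (l := 0).1 h)⟩

/-- Every positive number strictly exceeds some 2^(-k), so weak bounds by powers of two suffice. On
a common grid the difference with the number can be moved across the inequality. -/
theorem isNumberish_iff {G : ShortGame} : G.IsNumberish ↔ ∃ (m : ℤ) (k₀ : ℕ), ∀ k ≥ k₀,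
    Le G (ofDyadic (1 + m * 2 ^ (k - k₀)) k) ∧ Le (ofDyadic (-1 + m * 2 ^ (k - k₀)) k) G := by
  constructor
  · rintro ⟨x, ⟨m, k₀, hx⟩, hinf⟩
    refine ⟨m, k₀, fun k hk => ?_⟩
    rw [exists_ofDyadic_eq hk] at hx
    obtain ⟨h₁, h₂⟩ := hinf _ (ofDyadic_one_isNumber k) (zero_lt_ofDyadic_one k)
    rw [← ofDyadic_neg] at h₁
    exact ⟨le_trans (sub_le_iff.1 h₂.1) (le_trans (add_le_add_right hx.1 _) (ofDyadic_add _ _ _).1),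
      le_trans (ofDyadic_add _ _ _).2 (le_trans (add_le_add_right hx.2 _) (le_sub_iff.1 h₁.1))⟩
  · rintro ⟨m, k₀, h⟩
    refine ⟨ofDyadic m k₀, ⟨m, k₀, le_refl _, le_refl _⟩, fun y hy hy₀ => ?_⟩
    obtain ⟨k, hk, hlt⟩ := exists_ofDyadic_one_lt hy hy₀ k₀
    obtain ⟨h₁, h₂⟩ := h k hk
    have hupper : Le (G.sub (ofDyadic m k₀)) (ofDyadic 1 k) := by
      rw [sub_le_iff, exists_ofDyadic_eq hk]
      exact le_trans h₁ (ofDyadic_add _ _ _).2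
    have hlower : Le (ofDyadic 1 k).neg (G.sub (ofDyadic m k₀)) := by
      rw [le_sub_iff, exists_ofDyadic_eq hk, ← ofDyadic_neg]
      exact le_trans (ofDyadic_add _ _ _).1 h₂
    refine ⟨⟨le_trans (neg_le_neg_of_le hlt.1) hlower, fun hc => hlt.2 ?_⟩,
      le_trans hupper hlt.1, fun hc => hlt.2 (le_trans hc hupper)⟩
    have := neg_le_neg_of_le (le_trans hlower hc)
    rwa [neg_neg, neg_neg] at this

theorem IsNumber.isNumberish {G : ShortGame} (h : G.IsNumber) : G.IsNumberish := by
  obtain ⟨m, k₀, hm⟩ := h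
  refine isNumberish_iff.2 ⟨m, k₀, fun k hk => ?_⟩
  rw [exists_ofDyadic_eq hk] at hm
  exact ⟨le_trans hm.1 (ofDyadic_le_iff.2 (by omega)),
    le_trans (ofDyadic_le_iff.2 (by omega)) hm.2⟩

theorem IsInteger.isNumber {G : ShortGame} (h : G.IsInteger) : G.IsNumber := by
  obtain ⟨n, hn⟩ := h
  exact ⟨n, 0, hn⟩

section Temperature

variable {G : ShortGame} (hG : ¬ G.IsNumber) {τ : DyadicRationals}
  (hτ : IsLeast {t | G.leftScaffold t = G.rightScaffold t} τ)

include hG hτ in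
theorem crossing_nonneg : 0 ≤ τ := by
  rw [← neg_nonpos]
  refine nonpos_of_le_dyadic_one (k₀ := 0) fun k _ => ?_
  have := lt_of_isLeast_crossing (fun h => hG h.isNumber) (fun i => wallsApproximate _)
    (fun j => wallsApproximate _) hτ (k := k) fun ⟨n, hn⟩ => hG ⟨n, k, hn⟩
  rw [dyadic_neg] at this
  linarith

include hG in
-- From -2^(-k) to 0 the left scaffold drops by at most one grid step, so its value at 0 bounds G
-- from above up to 2^(-k).
theorem le_ofDyadic_add_one_of_leftScaffold_zero {n : ℤ} {k : ℕ}
    (h : G.leftScaffold 0 ≤ dyadic n k) : Le G (ofDyadic (1 + n) k) := by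
  have hI : ¬ G.IsInteger := fun h => hG h.isNumber
  rw [le_iff_leftScaffold_le hI (fun i => wallsApproximate _) fun ⟨n, hn⟩ => hG ⟨n, k, hn⟩]
  have h₁ := dyadic_one_pos k
  have h₂ := dyadic_neg 1 k
  have h₃ := (isWall_leftScaffold hI fun i => wallsApproximate _).mono
    (show dyadic (-1) k ≤ 0 by linarith)
  rw [dyadic_add]
  linarith

include hG in
theorem ofDyadic_sub_one_le_of_rightScaffold_zero {n : ℤ} {k : ℕ}
    (h : dyadic n k ≤ G.rightScaffold 0) : Le (ofDyadic (-1 + n) k) G := by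
  have hI : ¬ G.IsInteger := fun h => hG h.isNumber
  rw [ge_iff_le_rightScaffold hI (fun i => wallsApproximate _) fun ⟨n, hn⟩ => hG ⟨n, k, hn⟩]
  have h₁ := dyadic_one_pos k
  have h₂ := dyadic_neg 1 k
  have h₃ := (isWall_rightScaffold hI fun i => wallsApproximate _).mono
    (show dyadic (-1) k ≤ 0 by linarith)
  rw [dyadic_add]
  linarith

include hG in
theorem leftScaffold_zero_le {n : ℤ} {k : ℕ} (h : Le G (ofDyadic n k)) :
    G.leftScaffold 0 ≤ dyadic n k := by
  have hI : ¬ G.IsInteger := fun h => hG h.isNumber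
  rw [le_iff_leftScaffold_le hI (fun i => wallsApproximate _) fun ⟨n, hn⟩ => hG ⟨n, k, hn⟩] at h
  have h₁ := dyadic_one_pos k
  have h₂ := dyadic_neg 1 k
  exact ((isWall_leftScaffold hI fun i => wallsApproximate _).anti
    (show dyadic (-1) k ≤ 0 by linarith)).trans h

include hG in
theorem le_rightScaffold_zero {n : ℤ} {k : ℕ} (h : Le (ofDyadic n k) G) :
    dyadic n k ≤ G.rightScaffold 0 := by
  have hI : ¬ G.IsInteger := fun h => hG h.isNumber
  rw [ge_iff_le_rightScaffold hI (fun i => wallsApproximate _) fun ⟨n, hn⟩ => hG ⟨n, k, hn⟩] at h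
  have h₁ := dyadic_one_pos k
  have h₂ := dyadic_neg 1 k
  exact h.trans (neg_le_neg_iff.1 ((isWall_rightScaffold hI fun i => wallsApproximate _).anti
    (show dyadic (-1) k ≤ 0 by linarith)))

include hG hτ in
theorem crossing_eq_zero_iff : τ = 0 ↔ G.IsNumberish := by
  have hI : ¬ G.IsInteger := fun h => hG h.isNumber
  have hτ₀ := crossing_nonneg hG hτ
  have hτ' : G.leftScaffold τ = G.rightScaffold τ := hτ.1
  constructor
  · rintro rfl
    obtain ⟨m, k₀, hm⟩ := exists_eq_dyadic (G.leftScaffold 0)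
    refine isNumberish_iff.2 ⟨m, k₀, fun k hk => ?_⟩
    rw [exists_dyadic_eq hk] at hm
    exact ⟨le_ofDyadic_add_one_of_leftScaffold_zero hG hm.le,
      ofDyadic_sub_one_le_of_rightScaffold_zero hG (hm.symm.trans hτ').le⟩
  · intro h
    obtain ⟨m, k₀, h⟩ := isNumberish_iff.1 h
    -- Letting k grow, the scaffolds at 0 lie on the meeting side of m / 2^k₀. As they have not
    -- passed each other before τ ≥ 0, they are equal at 0.
    have hl : G.leftScaffold 0 - dyadic m k₀ ≤ 0 := by
      refine nonpos_of_le_dyadic_one (k₀ := k₀) fun k hk => ?_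
      have := leftScaffold_zero_le hG (h k hk).1
      rw [dyadic_add, ← exists_dyadic_eq hk] at this
      linarith
    have hr : dyadic m k₀ - G.rightScaffold 0 ≤ 0 := by
      refine nonpos_of_le_dyadic_one (k₀ := k₀) fun k hk => ?_
      have := le_rightScaffold_zero hG (h k hk).2
      rw [dyadic_add, ← exists_dyadic_eq hk, dyadic_neg] at this
      linarith
    have := scaffold_sub_antitone hI (fun i => wallsApproximate _) (fun j => wallsApproximate _) hτ₀
    simp only at this
    exact le_antisymm (hτ.2 (show _ = _ by linarith)) hτ₀

end Temperature

end ShortGame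

theorem corollary7p2 (G : ShortGame) :
    -- outside the integers, the maximum, the minimum and the least crossing point that define
    -- the temperature exist
    (¬ G.IsInteger →
      0 < G.numLeft ∧ 0 < G.numRight ∧
        ∃ τ : DyadicRationals, G.temperature = (τ : WithBot DyadicRationals) ∧
          IsLeast {t : DyadicRationals | G.leftScaffold t = G.rightScaffold t} τ) ∧
    (G.temperature < 0 ↔ G.IsNumber) ∧
    (G.temperature = 0 ↔ G.IsNumberish ∧ ¬ G.IsNumber) ∧
    (0 < G.temperature ↔ ¬ G.IsNumberish) := by
  open ShortGame in
  by_cases hI : G.IsInteger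
  · have hnum := hI.isNumber
    have hnsh := hnum.isNumberish
    obtain ⟨n, -, hth⟩ := exists_thermograph_of_isInteger hI
    have ht : G.temperature = ⊥ := by rw [temperature, hth]
    rw [ht]
    have h₀ : (⊥ : WithBot DyadicRationals) < 0 := WithBot.bot_lt_coe 0
    exact ⟨fun h => absurd hI h, by simp [h₀, hnum], by simp [h₀.ne, hnum],
      by simp [h₀.not_gt, hnsh]⟩
  · obtain ⟨τ, hτ⟩ := exists_isLeast_crossing hI (fun i => wallsApproximate _)
      (fun j => wallsApproximate _)
    have ht := temperature_eq hI hτ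
    refine ⟨fun _ => ⟨numLeft_pos hI, numRight_pos hI, τ, ht, hτ⟩, ?_⟩
    rw [ht, ← WithBot.coe_zero, WithBot.coe_lt_coe, WithBot.coe_lt_coe, WithBot.coe_inj]
    by_cases hnum : G.IsNumber
    · have hnsh := hnum.isNumberish
      obtain ⟨n, k, hn⟩ := hnum
      have h := (mast_of_eqv_ofDyadic hI (fun i => wallsApproximate _)
        (fun j => wallsApproximate _) hτ hn).1
      rw [dyadic_neg] at h
      have hneg : τ < 0 := by have := dyadic_one_pos k; linarith
      have hnum : G.IsNumber := ⟨n, k, hn⟩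
      simp [hneg, hneg.ne, hneg.not_gt, hnum, hnsh]
    · have h₀ := crossing_nonneg hnum hτ
      have h := crossing_eq_zero_iff hnum hτ
      simp only [hnum, iff_false, not_lt, h₀, not_false_eq_true, and_true, h, true_and]
      rw [← h, lt_iff_le_and_ne]
      exact ⟨fun h => h.2.symm, fun h => ⟨h₀, Ne.symm h⟩⟩
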